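/- \textbf{Turnstile model.} Nodes are labelled $1,\dots,n$. A turnstile stream of a simple graph $G$ is a finite list of insertions and deletions of unordered pairs of nodes, in arbitrary order, such that for every pair the number of insertions minus the number of deletions is $1$ if the pair is an edge of $G$ and $0$ otherwise. A randomized streaming algorithm with $s$ bits of space has a memory of $s$ bits; it initializes its memory from its input, then reads the same stream, item by item, in each of its passes (it is notified at the end of a pass), and finally produces its output from the contents of its memory. It may toss fresh coins at every step, but everything it remembers (including its input and earlier coin tosses) must be stored in the $s$ bits. The algorithm may depend on the parameters $n, c, k$, and only the memory kept between the reading of consecutive items is charged. \textbf{Steiner trees.} For a graph $G$ with unweighted edges and a set $S$ of nodes, a Steiner tree of $G$ for $S$ is a subgraph of $G$ that is a tree and contains all nodes of $S$; it is a $2$-approximate Steiner tree if its number of edges is at most twice the number of edges of every Steiner tree of $G$ for $S$. \textbf{Corollary.} For every $d\in\mathbb{N}$ there are constants $C$ and $a$, depending only on $d$, such that for all integers $1\le c\le k\le n$ there is a randomized streaming algorithm that makes at most $C\,\frac{n}{k}\,\log^{a}(n+1)=\tilde O(n/k)$ passes, uses at most $C\,(cn+k^2)\log^{a}(n+1)=\tilde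 O(cn+k^2)$ bits of space, and has the following property. For every connected simple undirected graph $G$ on $n$ nodes with unweighted edges, every set $S$ of exactly $c$ nodes of $G$, given to the algorithm as its input, and every turnstile stream of $G$, the algorithm outputs a $2$-approximate Steiner tree of $G$ for $S$ with probability at least $1-1/n^{d}$. -/

import Mathlib

/-! ### Turnstile graph streams -/

/-- One item of a turnstile graph stream on the node set `V`: an edge (an unordered pair of nodes)
is inserted or deleted. -/
inductive EdgeUpdate (V : Type) where
  | insert (e : Sym2 V)
  | delete (e : Sym2 V)

/-- The change (`+1`, `-1` or `0`) that an update makes to the multiplicity of the pair `e`. -/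
def EdgeUpdate.sign {V : Type} [DecidableEq V] (e : Sym2 V) : EdgeUpdate V → ℤ
  | .insert f => if f = e then 1 else 0
  | .delete f => if f = e then -1 else 0

/-- The list `σ` of insertions and deletions is a turnstile stream of the simple graph `G`: after
the whole list, every edge of `G` has multiplicity one and every other pair has multiplicity zero.
The order of the updates and the intermediate multiplicities are arbitrary. -/
def IsTurnstileStream {V : Type} [DecidableEq V] (G : SimpleGraph V)
    (σ : List (EdgeUpdate V)) : Prop :=
  ∀ e : Sym2 V, (e ∈ G.edgeSet → (σ.map (EdgeUpdate.sign e)).sum = 1) ∧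
    (e ∉ G.edgeSet → (σ.map (EdgeUpdate.sign e)).sum = 0)

/-! ### Randomized multi-pass streaming algorithms -/

/-- A randomized streaming algorithm with `s` bits of memory. It writes its initial memory contents
knowing only `x : Input`; afterwards it sees the stream items `u : Update` one at a time, and is
told when a pass ends. Each action sees only the current memory contents (and the current item) and
may toss fresh coins; anything kept for later, such as the input, earlier coin tosses, or the number
of the pass, has to be stored in the `s` bits. The output is read off the final memory contents. -/
structure StreamingAlgorithm (Input Update Output : Type) (s : ℕ) where
  init : Input → PMF (Fin s → Bool)
  update : Update → (Fin s → Bool) → PMF (Fin s → Bool)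
  endPass : (Fin s → Bool) → PMF (Fin s → Bool)
  output : (Fin s → Bool) → Output

namespace StreamingAlgorithm

variable {Input Update Output : Type} {s : ℕ}

/-- Distribution of the memory after reading the items of the list one by one, starting in `m`. -/
noncomputable def read (A : StreamingAlgorithm Input Update Output s) :
    List Update → (Fin s → Bool) → PMF (Fin s → Bool)
  | [], m => PMF.pure m
  | u :: σ, m => (A.update u m).bind (A.read σ)

/-- Distribution of the memory after `p` complete passes over the stream `σ`, starting in `m`. -/
noncomputable def passes (A : StreamingAlgorithm Input Update Output s) (σ : List Update) :
    ℕ → (Fin s → Bool) → PMF (Fin s → Bool)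
  | 0, m => PMF.pure m
  | p + 1, m => ((A.read σ m).bind A.endPass).bind (A.passes σ p)

/-- Distribution of the output on input `x` after `p` passes over the stream `σ`. -/
noncomputable def run (A : StreamingAlgorithm Input Update Output s) (p : ℕ) (x : Input)
    (σ : List Update) : PMF Output :=
  ((A.init x).bind (A.passes σ p)).map A.output

end StreamingAlgorithm

/-! ### Steiner trees -/

/-- A graph whose nodes form a subset of `V`: a set of nodes, together with a set of edges between
these nodes. This is the type of the outputs; it does not depend on the input graph. -/
abbrev PartialGraph (V : Type) : Type := (⊤ : SimpleGraph V).Subgraph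

/-- `T` is a Steiner tree of `G` for the terminal set `S`: a tree all of whose edges are edges of
`G` and whose nodes include all of `S`. -/
def IsSteinerTree {V : Type} (G : SimpleGraph V) (S : Finset V) (T : PartialGraph V) : Prop :=
  T.edgeSet ⊆ G.edgeSet ∧ T.coe.IsTree ∧ (S : Set V) ⊆ T.verts

/-- `T` is a Steiner tree of the unweighted graph `G` for `S`, and it has at most twice as many
edges as any Steiner tree of `G` for `S`. -/
def IsTwoApproxSteinerTree {V : Type} (G : SimpleGraph V) (S : Finset V) (T : PartialGraph V) :
    Prop :=
  IsSteinerTree G S T ∧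
    ∀ T' : PartialGraph V, IsSteinerTree G S T' → T.edgeSet.ncard ≤ 2 * T'.edgeSet.ncard

/-! It suffices to know a subgraph `H` of `G` in which the distances from every terminal are those
of `G`. Walking around a Steiner tree of `G` uses each edge twice, and the stretches between
consecutive terminals can be replaced by shortest paths of `H`, so a smallest Steiner tree of `H` is
a 2-approximation (`isTwoApproxSteinerTree_of_minimal`). The union of one breadth-first tree per
terminal is such an `H`; it is stored as `c * n` parent pointers.

A single breadth-first search may need `n` rounds. To get by with `Õ(n / k)`, take `L` of order `(n
/ k) * log n` and add `k` random nodes as sources. With high probability they meet every shortest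
path of length `L`, so distances from terminals are composed of hops of length at most `L` between
sources (`routeDist_le_dist`). The hops fit into `Õ(k ^ 2)` bits, but the distances from all sources
to all nodes do not fit. Hence the searches run twice: once to find the hops, and once more to
combine them on the fly into the `c * n` distances from terminals.

The `c + k` searches run simultaneously. Random delays below `L` ensure that only `O((c + k) / L +
log n)` of them reach a given node in the same round, so all frontiers together have `Õ(n + k ^ 2)`
elements. A pass computes a linear sketch of the vector of neighbour counts, which is supported on
three consecutive frontiers and can therefore be decoded (`exists_sketch`, `searchInvariant_next`).
Linearity makes deletions harmless (`sum_contribution`). Once the distances are known,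
logarithmically many further passes find the parents, one bit per pass (`parentInvariant_next`). The
failure probability is bounded in `card_bad_seeds_mul_le`, the space in `space_exponent_le`. -/

/-! ### Linear sketches as streaming algorithms -/

namespace LinearSketch

open Classical in
/-- The sum of `f x y` over all ordered pairs of adjacent nodes. -/
noncomputable def graphSum {V A : Type} [Fintype V] [AddCommGroup A] (G : SimpleGraph V)
    (f : V → V → A) : A :=
  ∑ x, ∑ y, if G.Adj x y then f x y else 0

/-- The change that an update makes to the linear sketch with weights `f`. -/
noncomputable def contribution {V A : Type} [Fintype V] [DecidableEq V] [AddCommGroup A]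
    (f : V → V → A) (u : EdgeUpdate V) : A :=
  ∑ x, ∑ y, u.sign s(x, y) • f x y

/-- By linearity only the final multiplicity of each pair matters, and that is the indicator of
adjacency. One group element is therefore enough working memory for a pass. -/
theorem sum_contribution {V A : Type} [Fintype V] [DecidableEq V] [AddCommGroup A]
    {G : SimpleGraph V} {σ : List (EdgeUpdate V)} (h : IsTurnstileStream G σ) (f : V → V → A) :
    (σ.map (contribution f)).sum = graphSum G f := by
  have key : ∀ τ : List (EdgeUpdate V), (τ.map (contribution f)).sum =
      ∑ x, ∑ y, (τ.map (EdgeUpdate.sign s(x, y))).sum • f x y := by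
    intro τ
    induction τ with
    | nil => simp
    | cons u τ ih =>
      simp only [List.map_cons, List.sum_cons, add_smul, Finset.sum_add_distrib, ih]
      rfl
  rw [key]
  unfold graphSum
  refine Finset.sum_congr rfl fun x _ => Finset.sum_congr rfl fun y _ => ?_
  split_ifs with hxy
  · rw [(h s(x, y)).1 (by simpa using hxy), one_smul]
  · rw [(h s(x, y)).2 (by simpa using hxy), zero_smul]

/-- The state after `t` passes of the algorithm that asks in every pass for one sum over the edges
of the graph and updates its state accordingly. -/
noncomputable def stateAfter {V St A : Type} [Fintype V] [AddCommGroup A] (G : SimpleGraph V)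
    (query : ℕ → St → V → V → A) (next : ℕ → St → A → St) (m : St) : ℕ → St
  | 0 => m
  | t + 1 => next t (stateAfter G query next m t)
      (graphSum G (query t (stateAfter G query next m t)))

section Deterministic

variable {Input Update Output M : Type} {s : ℕ} (A : StreamingAlgorithm Input Update Output s)
  (e : M → Fin s → Bool) (upd : M → Update → M) (fin : M → M)

theorem read_eq_pure (hu : ∀ u m, A.update u (e m) = PMF.pure (e (upd m u)))
    (σ : List Update) (m : M) : A.read σ (e m) = PMF.pure (e (σ.foldl upd m)) := by
  induction σ generalizing m with
  | nil => rfl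
  | cons u σ ih => simp [StreamingAlgorithm.read, hu, ih]

theorem passes_eq_pure (hu : ∀ u m, A.update u (e m) = PMF.pure (e (upd m u)))
    (hf : ∀ m, A.endPass (e m) = PMF.pure (e (fin m))) (σ : List Update) (p : ℕ) (m : M) :
    A.passes σ p (e m) = PMF.pure (e ((fun m => fin (σ.foldl upd m))^[p] m)) := by
  induction p generalizing m with
  | zero => rfl
  | succ p ih =>
    simp [StreamingAlgorithm.passes, read_eq_pure A e upd hu, hf, ih]

end Deterministic

/-- Any algorithm that in each pass computes one sum over the edges, with values in a finite group,
from its current state, and that tosses coins only at the start, can be run on a turnstile stream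
in a memory large enough for its seed, its state, the pass number and the sum. -/
theorem exists_streamingAlgorithm {V Input Ω Θ St A Output : Type} [Fintype V] [DecidableEq V]
    [Fintype Ω] [Nonempty Ω] [Fintype Θ] [Nonempty Θ] [Fintype St] [AddCommGroup A] [Fintype A]
    (P s : ℕ)
    (hs : Fintype.card Θ * Fintype.card St * (P + 1) * Fintype.card A ≤ 2 ^ s)
    (seed : Input → Ω → Θ) (m₀ : Θ → St) (query : Θ → ℕ → St → V → V → A)
    (next : Θ → ℕ → St → A → St) (out : Θ → St → Output) :
    ∃ Alg : StreamingAlgorithm Input (EdgeUpdate V) Output s,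
      ∀ (G : SimpleGraph V) (σ : List (EdgeUpdate V)), IsTurnstileStream G σ → ∀ x : Input,
        Alg.run P x σ = (PMF.uniformOfFintype Ω).map fun ω =>
          out (seed x ω) (stateAfter G (query (seed x ω)) (next (seed x ω)) (m₀ (seed x ω)) P) := by
  classical
  let M : Type := Θ × St × Fin (P + 1) × A
  obtain ⟨e⟩ : Nonempty (M ↪ (Fin s → Bool)) := by
    apply Function.Embedding.nonempty_of_card_le
    simpa [M, mul_assoc] using hs
  have : Nonempty M := ⟨(Classical.arbitrary Θ, m₀ (Classical.arbitrary Θ), 0, 0)⟩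
  let d : (Fin s → Bool) → M := Function.invFun e
  have hd : ∀ m, d (e m) = m := Function.leftInverse_invFun e.injective
  let upd : M → EdgeUpdate V → M := fun m u =>
    (m.1, m.2.1, m.2.2.1, m.2.2.2 + contribution (query m.1 m.2.2.1 m.2.1) u)
  let fin : M → M := fun m =>
    (m.1, next m.1 m.2.2.1 m.2.1 m.2.2.2, Fin.ofNat (P + 1) (m.2.2.1 + 1), 0)
  let Alg : StreamingAlgorithm Input (EdgeUpdate V) Output s :=
    { init := fun x => (PMF.uniformOfFintype Ω).map fun ω => e (seed x ω, m₀ (seed x ω), 0, 0)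
      update := fun u m => PMF.pure (e (upd (d m) u))
      endPass := fun m => PMF.pure (e (fin (d m)))
      output := fun m => out (d m).1 (d m).2.1 }
  refine ⟨Alg, fun G σ hσ x => ?_⟩
  have hfold : ∀ (τ : List (EdgeUpdate V)) (m : M), τ.foldl upd m = (m.1, m.2.1, m.2.2.1,
      m.2.2.2 + (τ.map (contribution (query m.1 m.2.2.1 m.2.1))).sum) := by
    intro τ
    induction τ with
    | nil => intro m; simp
    | cons u τ ih => intro m; simp [ih, upd, add_assoc]
  have hiter : ∀ (θ : Θ) (t : ℕ), t ≤ P →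
      (fun m => fin (σ.foldl upd m))^[t] ((θ, m₀ θ, 0, 0) : M) =
        (θ, stateAfter G (query θ) (next θ) (m₀ θ) t, Fin.ofNat (P + 1) t, 0) := by
    intro θ t
    induction t with
    | zero => intro _; rfl
    | succ t ih =>
      intro ht
      rw [Function.iterate_succ_apply', ih (by omega), hfold]
      have h1 : ((Fin.ofNat (P + 1) t : Fin (P + 1)) : ℕ) = t := by
        simp [Fin.ofNat, Nat.mod_eq_of_lt (show t < P + 1 by omega)]
      simp only [fin, h1, zero_add, sum_contribution hσ]
      rfl
  have hp : ∀ m : M, Alg.passes σ P (e m) =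
      PMF.pure (e ((fun m => fin (σ.foldl upd m))^[P] m)) := fun m =>
    passes_eq_pure Alg e upd fin (fun u m => by simp [Alg, hd]) (fun m => by simp [Alg, hd]) σ P m
  have hb : (Alg.init x).bind (Alg.passes σ P) = (PMF.uniformOfFintype Ω).map fun ω =>
      e ((seed x ω, stateAfter G (query (seed x ω)) (next (seed x ω)) (m₀ (seed x ω)) P,
        Fin.ofNat (P + 1) P, 0) : M) := by
    simp only [Alg, PMF.bind_map]
    change _ = (PMF.uniformOfFintype Ω).bind _
    congr 1
    funext ω
    have := hp (seed x ω, m₀ (seed x ω), 0, 0)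
    rw [hiter _ _ le_rfl] at this
    exact this
  unfold StreamingAlgorithm.run
  rw [hb, PMF.map_comp]
  congr 1
  funext ω
  simp [Alg, hd]

end LinearSketch

/-! ### Distances, closed walks and Steiner trees -/

namespace SteinerGraph

open SimpleGraph

theorem exists_dist_split {V : Type} {G : SimpleGraph V} (hG : G.Connected) (u v : V) {j : ℕ}
    (hj : j ≤ G.dist u v) : ∃ x, G.dist u x = j ∧ G.dist u x + G.dist x v = G.dist u v := by
  obtain ⟨p, hp⟩ := hG.exists_walk_length_eq_dist u v
  refine ⟨p.getVert j, ?_⟩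
  have h1 := dist_le (p.take j)
  have h2 := dist_le (p.drop j)
  have h3 := hG.dist_triangle (u := u) (v := p.getVert j) (w := v)
  rw [Walk.take_length] at h1
  rw [Walk.drop_length] at h2
  omega

theorem dist_lt_card {V : Type} [Fintype V] {G : SimpleGraph V} (hG : G.Connected) (u v : V) :
    G.dist u v < Fintype.card V := by
  obtain ⟨p, hp, hl⟩ := hG.exists_path_of_dist u v
  rw [← hl]
  exact hp.length_lt

/-- A connected graph has a closed walk through all nodes that uses `2 (|V| - 1)` edges. -/
theorem exists_closed_walk {V : Type} [Fintype V] [DecidableEq V] {G : SimpleGraph V}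
    (hG : G.Connected) (r : V) :
    ∃ p : G.Walk r r, p.length + 2 ≤ 2 * Fintype.card V ∧ ∀ v, v ∈ p.support := by
  -- Each node beyond `r` is added by a detour along one edge and straight back, which costs two
  -- steps.
  have key : ∀ j, j < Fintype.card V → ∃ p : G.Walk r r,
      p.length + 2 = 2 * p.support.toFinset.card ∧ j < p.support.toFinset.card := by
    intro j
    induction j with
    | zero => intro _; exact ⟨Walk.nil, by simp⟩
    | succ j ih =>
      intro hj
      obtain ⟨p, hp, hpj⟩ := ih (by omega)
      by_cases hlt : j + 1 < p.support.toFinset.card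
      · exact ⟨p, hp, hlt⟩
      obtain ⟨z, hz⟩ : ∃ z, z ∉ p.support := by
        by_contra! hall
        have : p.support.toFinset = Finset.univ := by ext; simp [hall]
        rw [this, Finset.card_univ] at hlt
        exact hlt hj
      obtain ⟨q⟩ := hG.preconnected r z
      obtain ⟨d, -, hd1, hd2⟩ := q.exists_boundary_dart {v | v ∈ p.support} (by simp) hz
      simp only [Set.mem_ofPred_eq] at hd1 hd2
      let w : G.Walk r r := (p.takeUntil d.fst hd1).append
        (Walk.cons d.adj (Walk.cons d.adj.symm (p.dropUntil d.fst hd1)))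
      have hlen : w.length = p.length + 2 := by
        have := congrArg Walk.length (p.take_spec hd1)
        simp only [Walk.length_append] at this
        simp only [w, Walk.length_append, Walk.length_cons]
        omega
      have hsup : w.support.toFinset = insert d.snd p.support.toFinset := by
        ext v
        have : v ∈ p.support ↔ v ∈ (p.takeUntil d.fst hd1).support ∨
            v ∈ (p.dropUntil d.fst hd1).support := by
          rw [← Walk.mem_support_append_iff, p.take_spec hd1]
        have h2 : d.fst ∈ (p.dropUntil d.fst hd1).support := Walk.start_mem_support _
        simp only [w, List.mem_toFinset, Finset.mem_insert, this, Walk.mem_support_append_iff,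
          Walk.support_cons, List.mem_cons]
        constructor
        · rintro (h | h | h | h)
          · tauto
          · subst h; tauto
          · tauto
          · tauto
        · tauto
      refine ⟨w, ?_, ?_⟩
      · rw [hsup, Finset.card_insert_of_notMem (by simpa using hd2)]; omega
      · rw [hsup, Finset.card_insert_of_notMem (by simpa using hd2)]; omega
  have hpos : 0 < Fintype.card V := Fintype.card_pos_iff.2 ⟨r⟩
  obtain ⟨p, hp, hc⟩ := key (Fintype.card V - 1) (by omega)
  have hle := Finset.card_le_univ p.support.toFinset
  refine ⟨p, by omega, fun v => ?_⟩
  have : p.support.toFinset = Finset.univ := Finset.eq_univ_of_card _ (by omega)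
  have hv := Finset.mem_univ v
  rw [← this] at hv
  simpa using hv

/-- If `H` preserves the distances from the terminals, then a walk of `G` can be replaced by a walk
of `H` that visits the same terminals and is not longer. -/
theorem exists_walk_through_terminals {V : Type} {G H : SimpleGraph V} (hG : G.Connected)
    (S : Finset V) (hH : ∀ s ∈ S, ∀ v, ∃ p : H.Walk s v, p.length = G.dist s v)
    {u y : V} (w : G.Walk u y) : ∀ s ∈ S, ∃ (z : V) (p : H.Walk s z),
      p.length ≤ G.dist s u + w.length ∧ ∀ t ∈ S, t ∈ w.support → t ∈ p.support := by
  classical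
  induction w with
  | nil =>
    rename_i u
    intro s hs
    obtain ⟨p, hp⟩ := hH s hs u
    exact ⟨u, p, by simp [hp], fun t _ ht => by simp at ht; subst ht; simp⟩
  | cons h w ih =>
    rename_i u u' y
    intro s hs
    have huu' : G.dist u u' = 1 := dist_eq_one_iff_adj.2 h
    -- Here `s` is the last terminal passed and `G.dist s u` the length still owed. At a terminal
    -- the debt is paid by a shortest path of `H`; elsewhere one step of the walk increases it by at
    -- most one.
    by_cases hu : u ∈ S
    · obtain ⟨p, hp⟩ := hH s hs u
      obtain ⟨z, q, hq, hqs⟩ := ih u hu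
      refine ⟨z, p.append q, ?_, fun t htS ht => ?_⟩
      · simp only [Walk.length_append, Walk.length_cons]; omega
      · rw [Walk.mem_support_append_iff]
        rcases List.mem_cons.1 ht with ht | ht
        · subst ht; simp
        · exact Or.inr (hqs t htS ht)
    · obtain ⟨z, q, hq, hqs⟩ := ih s hs
      refine ⟨z, q, ?_, fun t htS ht => ?_⟩
      · have := hG.dist_triangle (u := s) (v := u) (w := u')
        simp only [Walk.length_cons]; omega
      · rcases List.mem_cons.1 ht with ht | ht
        · subst ht; exact absurd htS hu
        · exact hqs t htS ht

theorem ncard_edgeSet_add_one {V : Type} [Fintype V] (T : PartialGraph V) (hT : T.coe.IsTree) :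
    T.edgeSet.ncard + 1 = T.verts.ncard := by
  have h := (isTree_iff_connected_and_card.1 hT).2
  rw [← Subgraph.image_coe_edgeSet_coe,
    Set.ncard_image_of_injective _ (Sym2.map.injective Subtype.val_injective)]
  simpa [Set.ncard] using h

/-- The nodes of a walk carry a tree with at most as many edges as the walk. -/
theorem exists_tree_of_walk {V : Type} [Fintype V] {H : SimpleGraph V} {u v : V}
    (p : H.Walk u v) : ∃ T : PartialGraph V, T.edgeSet ⊆ H.edgeSet ∧ T.coe.IsTree ∧
      T.verts = {x | x ∈ p.support} ∧ T.edgeSet.ncard ≤ p.length := by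
  classical
  obtain ⟨T₀, hle, hT₀⟩ := p.toSubgraph_connected.coe.exists_isTree_le
  let T : PartialGraph V :=
    { verts := p.toSubgraph.verts
      Adj := fun x y => ∃ (hx : x ∈ p.toSubgraph.verts) (hy : y ∈ p.toSubgraph.verts),
        T₀.Adj ⟨x, hx⟩ ⟨y, hy⟩
      adj_sub := by
        rintro x y ⟨hx, hy, h⟩
        exact fun hxy => T₀.ne_of_adj h (Subtype.ext hxy)
      edge_vert := by rintro x y ⟨hx, hy, h⟩; exact hx
      symm := ⟨by rintro x y ⟨hx, hy, h⟩; exact ⟨hy, hx, h.symm⟩⟩ }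
  have hcoe : T.coe = T₀ := by
    ext x y
    exact ⟨fun ⟨_, _, h⟩ => h, fun h => ⟨x.2, y.2, h⟩⟩
  have htree : T.coe.IsTree := by rw [hcoe]; exact hT₀
  have hverts : T.verts = {x | x ∈ p.support} := by ext x; simp [T]
  refine ⟨T, ?_, htree, hverts, ?_⟩
  · intro e
    induction e with
    | h x y =>
      rintro ⟨hx, hy, h⟩
      exact p.toSubgraph.adj_sub (hle h)
  · have h1 := ncard_edgeSet_add_one T htree
    have h2 : T.verts.ncard ≤ p.support.length := by
      rw [hverts, ← List.coe_toFinset, Set.ncard_coe_finset]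
      exact List.toFinset_card_le _
    rw [Walk.length_support] at h2
    omega

/-- A shortest Steiner tree of a subgraph that preserves the distances from the terminals is a
2-approximate Steiner tree. -/
theorem isTwoApproxSteinerTree_of_minimal {V : Type} [Fintype V] {G H : SimpleGraph V}
    (hG : G.Connected) (hHG : H ≤ G) {S : Finset V} (hS : S.Nonempty)
    (hH : ∀ s ∈ S, ∀ v, ∃ p : H.Walk s v, p.length = G.dist s v) :
    (∃ T, IsSteinerTree H S T) ∧ ∀ T, IsSteinerTree H S T →
      (∀ T', IsSteinerTree H S T' → T.edgeSet.ncard ≤ T'.edgeSet.ncard) →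
      IsTwoApproxSteinerTree G S T := by
  classical
  obtain ⟨s, hs⟩ := hS
  have key : ∀ w : G.Walk s s, (∀ t ∈ S, t ∈ w.support) →
      ∃ T, IsSteinerTree H S T ∧ T.edgeSet.ncard ≤ w.length := by
    intro w hw
    obtain ⟨z, p, hp, hpS⟩ := exists_walk_through_terminals hG S hH w s hs
    obtain ⟨T, hT1, hT2, hT3, hT4⟩ := exists_tree_of_walk p
    refine ⟨T, ⟨hT1, hT2, fun t ht => ?_⟩, ?_⟩
    · rw [hT3]; exact hpS t ht (hw t ht)
    · rw [dist_self] at hp; omega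
  constructor
  · obtain ⟨w, -, hw⟩ := exists_closed_walk hG s
    obtain ⟨T, hT, -⟩ := key w fun t _ => hw t
    exact ⟨T, hT⟩
  · intro T hT hmin
    refine ⟨⟨hT.1.trans (edgeSet_mono hHG), hT.2.1, hT.2.2⟩, fun T' hT' => ?_⟩
    -- The factor 2 arises here: the tour of `T'` has at most twice as many steps as `T'` has edges.
    obtain ⟨w, hwl, hw⟩ := exists_closed_walk hT'.2.1.connected ⟨s, hT'.2.2 hs⟩
    let f : T'.coe →g G := ⟨Subtype.val, fun {a b} h => hT'.1 (show s(a.1, b.1) ∈ T'.edgeSet from h)⟩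
    obtain ⟨T₁, hT₁, hl⟩ := key (w.map f) fun t ht => by
      rw [Walk.support_map]
      exact List.mem_map.2 ⟨⟨t, hT'.2.2 ht⟩, hw _, rfl⟩
    have h1 := hmin T₁ hT₁
    have h2 := ncard_edgeSet_add_one T' hT'.2.1
    have h3 : T'.verts.ncard = Fintype.card T'.verts := by
      rw [Set.ncard_eq_toFinset_card', Set.toFinset_card]
    rw [Walk.length_map] at hl
    omega

end SteinerGraph

/-! ### Recovery of sparse vectors from linear measurements -/

namespace SparseRecovery

/-- The measurements `∑ i, x i * α i ^ j` for `j < q` vanish on no nonzero vector with at most `q`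
nonzero entries. -/
theorem eq_zero_of_power_sums {F κ : Type} [Field F] [Fintype κ] [DecidableEq κ] [DecidableEq F]
    (α : κ → F) (hα : Function.Injective α) (q : ℕ) (x : κ → F)
    (hx : (Finset.univ.filter fun i => x i ≠ 0).card ≤ q)
    (h : ∀ j < q, ∑ i, x i * α i ^ j = 0) : x = 0 := by
  by_contra hne
  obtain ⟨i₀, hi₀⟩ : ∃ i, x i ≠ 0 := by
    by_contra! hall
    exact hne (funext hall)
  let s := (Finset.univ.filter fun i => x i ≠ 0).erase i₀
  -- `P` vanishes at all support points except `i₀` and has degree below `q`, so the vanishing power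
  -- sums isolate the entry at `i₀`.
  let P : Polynomial F := ∏ i ∈ s, (Polynomial.X - Polynomial.C (α i))
  have hdeg : P.natDegree < q := by
    have h1 : P.natDegree = s.card := by
      simp [P, Polynomial.natDegree_finsetProd_X_sub_C_eq_card]
    have h2 : s.card + 1 = (Finset.univ.filter fun i => x i ≠ 0).card :=
      Finset.card_erase_add_one (by simpa using hi₀)
    omega
  have hsum : ∑ i, x i * P.eval (α i) = 0 := by
    simp_rw [Polynomial.eval_eq_sum_range, Finset.mul_sum]
    rw [Finset.sum_comm]
    refine Finset.sum_eq_zero fun j hj => ?_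
    have := h j (by have := Finset.mem_range.1 hj; omega)
    calc ∑ i, x i * (P.coeff j * α i ^ j) = P.coeff j * ∑ i, x i * α i ^ j := by
          rw [Finset.mul_sum]; exact Finset.sum_congr rfl fun i _ => by ring
      _ = 0 := by rw [this, mul_zero]
  rw [Finset.sum_eq_single i₀] at hsum
  · rcases mul_eq_zero.1 hsum with h0 | h0
    · exact hi₀ h0
    · rw [Polynomial.eval_prod, Finset.prod_eq_zero_iff] at h0
      obtain ⟨i, hi, hi0⟩ := h0
      rw [Polynomial.eval_sub, Polynomial.eval_X, Polynomial.eval_C, sub_eq_zero] at hi0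
      exact Finset.ne_of_mem_erase hi (hα hi0).symm
  · intro i _ hi
    by_cases hxi : x i = 0
    · simp [hxi]
    · have : P.eval (α i) = 0 := by
        rw [Polynomial.eval_prod]
        exact Finset.prod_eq_zero (i := i)
          (Finset.mem_erase.2 ⟨hi, by simpa using hxi⟩) (by simp)
      simp [this]
  · simp

/-- Two vectors with at most `m` nonzero entries differ in at most `2 * m` places, so `2 * m` power
sums tell them apart. The decoder is a mere choice of preimage; its running time is not charged. -/
theorem exists_sketch {κ : Type} [Fintype κ] [DecidableEq κ] (p : ℕ) [Fact p.Prime]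
    (hκ : Fintype.card κ ≤ p) (m : ℕ) :
    ∃ (H : (κ → ZMod p) →+ (Fin (2 * m) → ZMod p))
      (dec : (Fin (2 * m) → ZMod p) → κ → ZMod p),
      ∀ x : κ → ZMod p, (Finset.univ.filter fun i => x i ≠ 0).card ≤ m → dec (H x) = x := by
  classical
  obtain ⟨α⟩ : Nonempty (κ ↪ ZMod p) :=
    Function.Embedding.nonempty_of_card_le (by rwa [ZMod.card])
  let H : (κ → ZMod p) →+ (Fin (2 * m) → ZMod p) :=
    { toFun := fun x j => ∑ i, x i * α i ^ (j : ℕ)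
      map_zero' := by ext; simp
      map_add' := fun x y => by ext; simp [add_mul, Finset.sum_add_distrib] }
  refine ⟨H, fun a => if h : ∃ x : κ → ZMod p,
    (Finset.univ.filter fun i => x i ≠ 0).card ≤ m ∧ H x = a then h.choose else 0, ?_⟩
  intro x hx
  have hex : ∃ y : κ → ZMod p,
    (Finset.univ.filter fun i => y i ≠ 0).card ≤ m ∧ H y = H x := ⟨x, hx, rfl⟩
  beta_reduce
  rw [dif_pos hex]
  obtain ⟨hy, hxy⟩ := hex.choose_spec
  rw [← sub_eq_zero]
  refine eq_zero_of_power_sums α α.injective (2 * m) _ ?_ fun j hj => ?_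
  · calc _ ≤ ((Finset.univ.filter fun i => hex.choose i ≠ 0) ∪
          (Finset.univ.filter fun i => x i ≠ 0)).card := by
          refine Finset.card_le_card fun i => ?_
          simp only [Finset.mem_filter, Finset.mem_univ, true_and, Finset.mem_union, Pi.sub_apply]
          intro h
          by_contra! h'
          exact h (by rw [h'.1, h'.2, sub_zero])
      _ ≤ _ := Finset.card_union_le _ _
      _ ≤ 2 * m := by omega
  · have := congrFun hxy ⟨j, hj⟩
    simp only [H, AddMonoidHom.coe_mk, ZeroHom.coe_mk] at this
    simp [sub_mul, Finset.sum_sub_distrib, this]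

end SparseRecovery

/-! ### Two tail bounds -/

namespace TailBound

/-- `(1 + 1 / L) ^ L ≤ e ≤ 4`, and `K` is at most `L * (K / L + 1)`. -/
theorem succ_pow_le (K L : ℕ) (hL : 0 < L) : (L + 1) ^ K ≤ L ^ K * 4 ^ (K / L + 1) := by
  have h1 : ((L : ℝ) + 1) / L = 1 + 1 / L := by field_simp
  have h2 : (1 + 1 / (L : ℝ)) ^ L ≤ 4 := by
    calc (1 + 1 / (L : ℝ)) ^ L ≤ (Real.exp (1 / L)) ^ L := by
          gcongr; rw [add_comm]; exact Real.add_one_le_exp _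
      _ = Real.exp 1 := by rw [← Real.exp_nat_mul]; congr 1; field_simp
      _ ≤ 4 := by linarith [Real.exp_one_lt_d9]
  have h3 : (1 + 1 / (L : ℝ)) ^ K ≤ 4 ^ (K / L + 1) := by
    calc (1 + 1 / (L : ℝ)) ^ K ≤ (1 + 1 / (L : ℝ)) ^ (L * (K / L + 1)) := by
          apply pow_le_pow_right₀ (by simp)
          have := Nat.lt_div_mul_add (a := K) hL
          rw [mul_add, mul_one, mul_comm]
          exact this.le
      _ = ((1 + 1 / (L : ℝ)) ^ L) ^ (K / L + 1) := pow_mul _ _ _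
      _ ≤ _ := by gcongr
  have h4 : ((L : ℝ) + 1) ^ K = L ^ K * (1 + 1 / (L : ℝ)) ^ K := by
    rw [← mul_pow]; congr 1; field_simp
  have : ((L : ℝ) + 1) ^ K ≤ L ^ K * 4 ^ (K / L + 1) := by rw [h4]; gcongr
  exact_mod_cast this

/-- Few choices of delays make many sources meet. -/
theorem card_many_coincidences_mul_le {ι : Type} [Fintype ι] [DecidableEq ι] (L b : ℕ)
    (hL : 0 < L) (a : ι → ℕ) (τ : ℕ) :
    (Finset.univ.filter fun x : ι → Fin L =>
      b ≤ (Finset.univ.filter fun i => (x i : ℕ) + a i = τ).card).card * 2 ^ b ≤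
      L ^ Fintype.card ι * 4 ^ (Fintype.card ι / L + 1) := by
  refine le_trans ?_ (succ_pow_le _ _ hL)
  calc _ = ∑ x : ι → Fin L, if b ≤ (Finset.univ.filter fun i => (x i : ℕ) + a i = τ).card
          then 2 ^ b else 0 := by rw [← Finset.sum_filter]; simp
    -- Markov's inequality for two to the number of coincidences; independence of the delays then
    -- turns the sum into a product, in which each factor has at most one delay of weight 2.
    _ ≤ ∑ x : ι → Fin L, 2 ^ (Finset.univ.filter fun i => (x i : ℕ) + a i = τ).card := by
        refine Finset.sum_le_sum fun x _ => ?_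
        split_ifs with h
        · exact Nat.pow_le_pow_right (by norm_num) h
        · exact Nat.zero_le _
    _ = ∑ x : ι → Fin L, ∏ i, if (x i : ℕ) + a i = τ then 2 else 1 := by
        refine Finset.sum_congr rfl fun x _ => ?_
        rw [Finset.prod_ite]; simp
    _ = ∏ i, ∑ y : Fin L, if (y : ℕ) + a i = τ then 2 else 1 := by
        rw [Finset.prod_univ_sum, Fintype.piFinset_univ]
    _ ≤ ∏ _i : ι, (L + 1) := by
        refine Finset.prod_le_prod' fun i _ => ?_
        have h1 : ∀ y : Fin L, (if (y : ℕ) + a i = τ then 2 else 1) =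
            1 + if (y : ℕ) + a i = τ then 1 else 0 := fun y => by split_ifs <;> rfl
        simp_rw [h1, Finset.sum_add_distrib, ← Finset.card_filter]
        have h2 : (Finset.univ.filter fun y : Fin L => (y : ℕ) + a i = τ).card ≤ 1 := by
          rw [Finset.card_le_one]
          intro y hy z hz
          simp only [Finset.mem_filter, Finset.mem_univ, true_and] at hy hz
          exact Fin.ext (by omega)
        simp only [Finset.sum_const, Finset.card_univ, Fintype.card_fin, smul_eq_mul, mul_one]
        omega
    _ = _ := by simp

/-- Few samples of `k` nodes miss a large set of nodes. -/
theorem card_missing_mul_le {V : Type} [Fintype V] [Nonempty V] [DecidableEq V] (L k ℓ : ℕ) (g : Finset V)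
    (hg : L ≤ g.card) (h : Fintype.card V * ℓ ≤ L * k) :
    (Finset.univ.filter fun Z : Fin k → V => ∀ i, Z i ∉ g).card * 2 ^ ℓ ≤
      Fintype.card V ^ k := by
  have h1 : (Finset.univ.filter fun Z : Fin k → V => ∀ i, Z i ∉ g) =
      Fintype.piFinset fun _ => gᶜ := by ext Z; simp
  rw [h1, Fintype.card_piFinset_const, Finset.card_compl]
  set n := Fintype.card V with hn
  have hpos : 0 < n := Fintype.card_pos
  have hgn : g.card ≤ n := Finset.card_le_univ g
  have hn0 : (0 : ℝ) < n := by exact_mod_cast hpos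
  -- One sample misses `g` with probability at most `1 - L / n ≤ exp (-L / n)`.
  have h2 : ((n - g.card : ℕ) : ℝ) ≤ n * Real.exp (-(L / n)) := by
    have := Real.add_one_le_exp (-((L : ℝ) / n))
    have h3 : (n : ℝ) * (-(L / n) + 1) ≤ n * Real.exp (-(L / n)) := by gcongr
    have h4 : (n : ℝ) * (-(L / n) + 1) = n - L := by field_simp; ring
    have h5 : (L : ℝ) ≤ g.card := by exact_mod_cast hg
    rw [Nat.cast_sub hgn]
    linarith
  have h6 : ((n - g.card : ℕ) : ℝ) ^ k * 2 ^ ℓ ≤ n ^ k := by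
    calc ((n - g.card : ℕ) : ℝ) ^ k * 2 ^ ℓ
        ≤ (n * Real.exp (-(L / n))) ^ k * (Real.exp 1) ^ ℓ := by
          gcongr
          linarith [Real.exp_one_gt_d9]
      _ = n ^ k * Real.exp (k * (-(L / n)) + ℓ * 1) := by
          rw [mul_pow, Real.exp_add, Real.exp_nat_mul, Real.exp_nat_mul]; ring
      _ ≤ n ^ k * 1 := by
          gcongr
          rw [Real.exp_le_one_iff]
          have : (n : ℝ) * ℓ ≤ L * k := by exact_mod_cast h
          have h7 : (ℓ : ℝ) ≤ k * (L / n) := by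
            rw [← mul_div_assoc, le_div_iff₀ hn0]; linarith
          linarith
      _ = n ^ k := mul_one _
  exact_mod_cast h6

end TailBound

/-! ### The algorithm: breadth-first searches with random delays, then parents -/

namespace SteinerStream

open LinearSketch SimpleGraph

/-! ### Routes composed of hops between sources -/

/-- The lengths of the routes from `i` to `j` composed of hops of lengths `T`. -/
inductive RouteLength {I : Type} (T : I → I → ℕ) (i : I) : I → ℕ → Prop
  | refl : RouteLength T i i 0
  | step {j : I} {ℓ : ℕ} (l : I) : RouteLength T i j ℓ → RouteLength T i l (ℓ + T j l)

/-- The length of a shortest route composed of hops of lengths `T`. -/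
noncomputable def routeDist {I : Type} (T : I → I → ℕ) (i j : I) : ℕ :=
  sInf {ℓ | RouteLength T i j ℓ}

theorem routeLength_routeDist {I : Type} (T : I → I → ℕ) (i j : I) :
    RouteLength T i j (routeDist T i j) :=
  Nat.sInf_mem (s := {ℓ | RouteLength T i j ℓ}) ⟨_, RouteLength.step j RouteLength.refl⟩

theorem routeDist_le_of_routeLength {I : Type} {T : I → I → ℕ} {i j : I} {ℓ : ℕ}
    (h : RouteLength T i j ℓ) : routeDist T i j ≤ ℓ :=
  Nat.sInf_le h

theorem routeDist_le {I : Type} (T : I → I → ℕ) (i j : I) : routeDist T i j ≤ T i j :=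
  routeDist_le_of_routeLength (by simpa using RouteLength.step j (RouteLength.refl (T := T)))

theorem routeDist_le_add {I : Type} (T : I → I → ℕ) (i j l : I) :
    routeDist T i l ≤ routeDist T i j + T j l :=
  routeDist_le_of_routeLength (.step l (routeLength_routeDist T i j))

/-- The triangle inequality along the hops: incomplete hop tables only overestimate, so early
estimates never do damage. -/
theorem dist_le_routeDist {V I : Type} {G : SimpleGraph V} (hG : G.Connected) {loc : I → V}
    {T : I → I → ℕ} (hT : ∀ i j, G.dist (loc i) (loc j) ≤ T i j) (i j : I) :
    G.dist (loc i) (loc j) ≤ routeDist T i j := by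
  have key : ∀ j ℓ, RouteLength T i j ℓ → G.dist (loc i) (loc j) ≤ ℓ := by
    intro j ℓ h
    induction h with
    | refl => simp
    | step l _ ih =>
      rename_i j' ℓ' _
      have := hG.dist_triangle (u := loc i) (v := loc j') (w := loc l)
      have := hT j' l
      omega
  exact key j _ (routeLength_routeDist T i j)

/-- Sets of at most `B` elements. -/
abbrev BoundedFinset (κ : Type) (B : ℕ) : Type := {F : Finset κ // F.card ≤ B}

/-- The set itself if it is small enough. -/
def clip {κ : Type} (B : ℕ) (F : Finset κ) : BoundedFinset κ B :=
  if h : F.card ≤ B then ⟨F, h⟩ else ⟨∅, by simp⟩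

theorem coe_clip {κ : Type} {B : ℕ} {F : Finset κ} (h : F.card ≤ B) :
    (clip B F : Finset κ) = F := by
  simp [clip, h]

/-- What the algorithm remembers between passes: the current and the previous frontiers of all
searches, the distances found between sources, the distances found from terminals to nodes, and the
bits known of the parents. -/
structure State (V I C : Type) (N B J : ℕ) where
  cur : BoundedFinset (I × V) B
  prev : BoundedFinset (I × V) B
  hop : I → I → Fin (N + 1)
  est : C → V → Fin (N + 1)
  bits : C → V → Fin J → Bool

/-- What stays fixed during a run: the number of rounds of the searches, their sources and delays,
which sources are the terminals, binary names of the nodes, and a sketch for sparse vectors. -/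
structure Config (V I C : Type) (p B J : ℕ) where
  rounds : ℕ
  loc : I → V
  delay : I → ℕ
  terminal : C → I
  code : V → Fin J → Bool
  sketch : (I × V → ZMod p) →+ (Fin (2 * (3 * B)) → ZMod p)
  decode : (Fin (2 * (3 * B)) → ZMod p) → I × V → ZMod p

/-- The values of the sums that a pass computes. -/
abbrev Answer (V C : Type) (p B : ℕ) : Type := (Fin (2 * (3 * B)) → ZMod p) × (C → V → ZMod p)

namespace Config

variable {V I C : Type} {p N B J : ℕ}

open Classical in
noncomputable def start [Fintype V] [Fintype I] (K : Config V I C p B J) : State V I C N B J where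
  cur := clip B (Finset.univ.filter fun κ => K.delay κ.1 = 0 ∧ κ.2 = K.loc κ.1)
  prev := ⟨∅, by simp⟩
  -- `N` will bound all distances, so it serves as the initial overestimate.
  hop := fun _ _ => Fin.last N
  est := fun _ _ => Fin.last N
  bits := fun _ _ _ => false

/-- `x` is a candidate for the parent of `w` in the search from `s`, given the first `j` bits, and
its next bit is set. -/
def IsCandidate (K : Config V I C p B J) (m : State V I C N B J) (j : ℕ) (s : C) (x w : V) :
    Prop :=
  (m.est s x : ℕ) + 1 = m.est s w ∧ (∀ i : Fin J, (i : ℕ) < j → K.code x i = m.bits s w i) ∧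
    ∃ h : j < J, K.code x ⟨j, h⟩ = true

open Classical in
/-- In the first rounds a pass counts, for every search and node, the neighbours in the frontier;
later it counts candidates for parents. -/
noncomputable def query (K : Config V I C p B J) (t : ℕ) (m : State V I C N B J) (x y : V) :
    Answer V C p B :=
  if t < K.rounds then
    (K.sketch fun κ => if κ.2 = y ∧ (κ.1, x) ∈ m.cur.1 then 1 else 0, 0)
  else (0, fun s w => if w = y ∧ K.IsCandidate m (t - K.rounds) s x y then 1 else 0)

-- Neighbours of a breadth-first layer lie in that layer, the preceding one or the following one, so
-- two stored frontiers determine the next. The number `t - K.delay i` is the distance at which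
-- search `i` arrives in round `t`.
open Classical in
noncomputable def next [Fintype V] [Fintype I] (K : Config V I C p B J) (t : ℕ)
    (m : State V I C N B J) (a : Answer V C p B) : State V I C N B J :=
  if t < K.rounds then
    { cur := clip B (Finset.univ.filter fun κ => (K.delay κ.1 = t + 1 ∧ κ.2 = K.loc κ.1) ∨
        (K.decode a.1 κ ≠ 0 ∧ κ ∉ m.cur.1 ∧ κ ∉ m.prev.1))
      prev := m.cur
      hop := fun i j => if (i, K.loc j) ∈ m.cur.1
        then min (m.hop i j) (Fin.ofNat (N + 1) (min (t - K.delay i) N)) else m.hop i j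
      est := fun s v => Fin.ofNat (N + 1) (sInf (insert (m.est s v : ℕ)
        {ℓ | ∃ i, (i, v) ∈ m.cur.1 ∧
          ℓ = routeDist (fun i j => (m.hop i j : ℕ)) (K.terminal s) i + (t - K.delay i)}))
      bits := m.bits }
  else
    { m with
      bits := fun s w i => if (i : ℕ) = t - K.rounds then decide (a.2 s w ≠ 0) else m.bits s w i }

end Config

/-! ### Sums over edges as neighbour counts -/

section GraphSum

variable {V A A' : Type} [Fintype V] [AddCommGroup A] [AddCommGroup A']

theorem graphSum_map (G : SimpleGraph V) (φ : A →+ A') (f : V → V → A) :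
    graphSum G (fun x y => φ (f x y)) = φ (graphSum G f) := by
  unfold graphSum
  simp only [map_sum]
  refine Finset.sum_congr rfl fun x _ => Finset.sum_congr rfl fun y _ => ?_
  split_ifs <;> simp

open Classical in
theorem graphSum_indicator (G : SimpleGraph V) (p : ℕ) (Q : V → V → Prop) (w : V) :
    graphSum G (fun x y => if w = y ∧ Q x y then (1 : ZMod p) else 0) =
      ((Finset.univ.filter fun x => G.Adj x w ∧ Q x w).card : ZMod p) := by
  unfold graphSum
  rw [Finset.card_filter]
  push_cast
  refine Finset.sum_congr rfl fun x _ => ?_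
  rw [Finset.sum_eq_single w]
  · by_cases h1 : G.Adj x w <;> by_cases h2 : Q x w <;> simp [h1, h2]
  · intro y _ hy
    simp [Ne.symm hy]
  · simp

/-- A count of nodes is below `p`, hence a positive count survives reduction modulo `p`. -/
theorem natCast_card_ne_zero_iff {V : Type} [Fintype V] {p : ℕ} (hp : Fintype.card V < p)
    (Q : V → Prop) [DecidablePred Q] :
    ((Finset.univ.filter Q).card : ZMod p) ≠ 0 ↔ ∃ x, Q x := by
  rw [Ne, ZMod.natCast_eq_zero_iff]
  have hlt : (Finset.univ.filter Q).card < p := lt_of_le_of_lt (Finset.card_le_univ _) hp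
  constructor
  · intro h
    by_contra! hno
    exact h (by simp [hno])
  · rintro ⟨x, hx⟩ hdvd
    have := Nat.eq_zero_of_dvd_of_lt hdvd hlt
    rw [Finset.card_eq_zero] at this
    have hx' : x ∈ Finset.univ.filter Q := by simpa using hx
    rw [this] at hx'
    simp at hx'

end GraphSum

namespace Config

variable {V I C : Type} [Fintype V] {p N B J : ℕ}

-- The sketch is additive, so it commutes with the sum over edges: the pass holds only the sketch of
-- the vector of counts, never the vector.
open Classical in
theorem graphSum_query_of_lt (K : Config V I C p B J) {t : ℕ} (ht : t < K.rounds)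
    (m : State V I C N B J) (G : SimpleGraph V) :
    (graphSum G (K.query t m)).1 = K.sketch fun κ =>
      ((Finset.univ.filter fun x => G.Adj x κ.2 ∧ (κ.1, x) ∈ m.cur.1).card : ZMod p) := by
  rw [← AddMonoidHom.coe_fst, ← graphSum_map]
  simp only [query, if_pos ht, AddMonoidHom.coe_fst]
  rw [graphSum_map G K.sketch]
  congr 1
  funext κ
  refine (graphSum_map G (Pi.evalAddMonoidHom (fun _ : I × V => ZMod p) κ) _).symm.trans ?_
  convert graphSum_indicator G p (fun x _ => (κ.1, x) ∈ m.cur.1) κ.2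
  rw [Pi.evalAddMonoidHom_apply]
  congr

open Classical in
theorem graphSum_query_of_not_lt (K : Config V I C p B J) {t : ℕ} (ht : ¬ t < K.rounds)
    (m : State V I C N B J) (G : SimpleGraph V) (s : C) (w : V) :
    (graphSum G (K.query t m)).2 s w = ((Finset.univ.filter fun x =>
      G.Adj x w ∧ K.IsCandidate m (t - K.rounds) s x w).card : ZMod p) := by
  rw [← graphSum_indicator G p (fun x y => K.IsCandidate m (t - K.rounds) s x y) w]
  let φ : Answer V C p B →+ ZMod p :=
    (Pi.evalAddMonoidHom (fun _ : V => ZMod p) w).comp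
      ((Pi.evalAddMonoidHom (fun _ : C => V → ZMod p) s).comp (AddMonoidHom.snd _ _))
  have h := graphSum_map G φ (K.query t m)
  rw [show (graphSum G (K.query t m)).2 s w = φ (graphSum G (K.query t m)) from rfl, ← h]
  congr 1
  funext x y
  simp only [query, if_neg ht]
  rfl

end Config

/-! ### Correctness of the searches for a valid seed -/

namespace Config

variable {V I C : Type} [Fintype V] {p N B J : ℕ}

/-- The conditions on seed and parameters under which the algorithm is correct on `G`: from time
`τ` on, the distances found before `τ` determine the distances from the terminals to the sources,
and every node is found by some search that starts after `τ` on its way from a terminal. -/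
structure IsValid (K : Config V I C p B J) (G : SimpleGraph V) (N τ : ℕ) : Prop where
  connected : G.Connected
  card_le : Fintype.card V ≤ N
  card_lt : Fintype.card V < p
  code_injective : Function.Injective K.code
  decode_sketch : ∀ x : I × V → ZMod p,
    {κ | x κ ≠ 0}.ncard ≤ 3 * B → K.decode (K.sketch x) = x
  frontier_card : ∀ t ≤ K.rounds, {κ : I × V | K.delay κ.1 + G.dist (K.loc κ.1) κ.2 = t}.ncard ≤ B
  routeDist_le : ∀ T : I → I → ℕ, (∀ i j, G.dist (K.loc i) (K.loc j) ≤ T i j) →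
    (∀ i j, K.delay i + G.dist (K.loc i) (K.loc j) < τ → T i j ≤ G.dist (K.loc i) (K.loc j)) →
    ∀ s i, τ ≤ K.delay i →
      routeDist T (K.terminal s) i ≤ G.dist (K.loc (K.terminal s)) (K.loc i)
  exists_source : ∀ s v, ∃ i, τ ≤ K.delay i ∧ K.delay i + G.dist (K.loc i) v < K.rounds ∧
    G.dist (K.loc (K.terminal s)) (K.loc i) + G.dist (K.loc i) v =
      G.dist (K.loc (K.terminal s)) v

/-- What holds after `t` rounds of the searches. -/
structure SearchInvariant (K : Config V I C p B J) (G : SimpleGraph V) (τ t : ℕ)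
    (m : State V I C N B J) : Prop where
  mem_cur : ∀ κ, κ ∈ m.cur.1 ↔ K.delay κ.1 + G.dist (K.loc κ.1) κ.2 = t
  mem_prev : ∀ κ, κ ∈ m.prev.1 ↔ K.delay κ.1 + G.dist (K.loc κ.1) κ.2 + 1 = t
  dist_le_hop : ∀ i j, G.dist (K.loc i) (K.loc j) ≤ m.hop i j
  hop_le : ∀ i j, K.delay i + G.dist (K.loc i) (K.loc j) < t →
    (m.hop i j : ℕ) ≤ G.dist (K.loc i) (K.loc j)
  dist_le_est : ∀ s v, G.dist (K.loc (K.terminal s)) v ≤ m.est s v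
  est_le : ∀ s i v, τ ≤ K.delay i → K.delay i + G.dist (K.loc i) v < t →
    (m.est s v : ℕ) ≤ G.dist (K.loc (K.terminal s)) (K.loc i) + G.dist (K.loc i) v

variable {K : Config V I C p B J} {G : SimpleGraph V} {τ : ℕ}

theorem IsValid.dist_le (hK : K.IsValid G N τ) (u v : V) : G.dist u v ≤ N :=
  (SteinerGraph.dist_lt_card hK.connected u v).le.trans hK.card_le

theorem val_ofNat_of_le {x : ℕ} (h : x ≤ N) : ((Fin.ofNat (N + 1) x : Fin (N + 1)) : ℕ) = x := by
  simp [Fin.ofNat, Nat.mod_eq_of_lt (show x < N + 1 by omega)]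

theorem IsValid.coe_clip_eq (hK : K.IsValid G N τ) {t : ℕ} (ht : t ≤ K.rounds) {F : Finset (I × V)}
    (hF : ∀ κ, κ ∈ F ↔ K.delay κ.1 + G.dist (K.loc κ.1) κ.2 = t) : (clip B F : Finset _) = F := by
  apply coe_clip
  have h1 : (F : Set (I × V)) = {κ | K.delay κ.1 + G.dist (K.loc κ.1) κ.2 = t} := by
    ext κ; simp [hF]
  have := hK.frontier_card t ht
  rwa [← h1, Set.ncard_coe_finset] at this

theorem searchInvariant_start [Fintype I] (hK : K.IsValid G N τ) :
    K.SearchInvariant (N := N) G τ 0 K.start where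
  mem_cur := by
    have h : ∀ κ : I × V, (K.delay κ.1 = 0 ∧ κ.2 = K.loc κ.1) ↔
        K.delay κ.1 + G.dist (K.loc κ.1) κ.2 = 0 := fun κ => by
      rw [Nat.add_eq_zero_iff, hK.connected.dist_eq_zero_iff, eq_comm (a := κ.2)]
    intro κ
    simp only [start]
    rw [hK.coe_clip_eq (Nat.zero_le _)] <;> simp [h]
  mem_prev := by simp [start]
  dist_le_hop := fun i j => by simpa [start] using hK.dist_le _ _
  hop_le := by simp
  dist_le_est := fun i j => by simpa [start] using hK.dist_le _ _
  est_le := by simp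

/-- Along an edge the distance from a source changes by at most one. Conversely, a node other than
the source is preceded on a shortest path by a neighbour in the layer before. -/
theorem mem_next_frontier (hK : K.IsValid G N τ) (t : ℕ) (κ : I × V) :
    ((K.delay κ.1 = t + 1 ∧ κ.2 = K.loc κ.1) ∨
      ((∃ x, G.Adj x κ.2 ∧ K.delay κ.1 + G.dist (K.loc κ.1) x = t) ∧
        ¬ K.delay κ.1 + G.dist (K.loc κ.1) κ.2 = t ∧
        ¬ K.delay κ.1 + G.dist (K.loc κ.1) κ.2 + 1 = t)) ↔
      K.delay κ.1 + G.dist (K.loc κ.1) κ.2 = t + 1 := by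
  obtain ⟨i, v⟩ := κ
  simp only
  constructor
  · rintro (⟨h1, rfl⟩ | ⟨⟨x, hx, hxt⟩, h2, h3⟩)
    · simpa using h1
    · have h4 := hK.connected.dist_triangle (u := K.loc i) (v := x) (w := v)
      have h5 := hK.connected.dist_triangle (u := K.loc i) (v := v) (w := x)
      rw [dist_eq_one_iff_adj.2 hx] at h4
      rw [dist_eq_one_iff_adj.2 hx.symm] at h5
      omega
  · intro h
    rcases Nat.eq_zero_or_pos (G.dist (K.loc i) v) with h0 | hpos
    · left
      exact ⟨by omega, (hK.connected.dist_eq_zero_iff.1 h0).symm⟩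
    · right
      obtain ⟨x, hx1, hx2⟩ := SteinerGraph.exists_dist_split hK.connected (K.loc i) v
        (j := G.dist (K.loc i) v - 1) (by omega)
      refine ⟨⟨x, dist_eq_one_iff_adj.1 (by omega), by omega⟩, by omega, by omega⟩

theorem searchInvariant_next [Fintype I] (hK : K.IsValid G N τ) {t : ℕ} (ht : t < K.rounds)
    {m : State V I C N B J} (hm : K.SearchInvariant G τ t m) :
    K.SearchInvariant G τ (t + 1) (K.next t m (graphSum G (K.query t m))) := by
  classical
  have hX : ∀ κ, K.decode (graphSum G (K.query t m)).1 κ ≠ 0 ↔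
      ∃ x, G.Adj x κ.2 ∧ K.delay κ.1 + G.dist (K.loc κ.1) x = t := by
    rw [graphSum_query_of_lt K ht]
    have hx : ∀ κ : I × V, ((Finset.univ.filter fun x =>
        G.Adj x κ.2 ∧ (κ.1, x) ∈ m.cur.1).card : ZMod p) ≠ 0 ↔
        ∃ x, G.Adj x κ.2 ∧ K.delay κ.1 + G.dist (K.loc κ.1) x = t := fun κ => by
      rw [natCast_card_ne_zero_iff hK.card_lt]
      simp [hm.mem_cur]
    rw [hK.decode_sketch]
    · exact hx
    -- Nonzero counts occur only in the previous, current and next frontiers, which explains the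
    -- sparsity `3 * B`.
    · have hsub : {κ : I × V | ((Finset.univ.filter fun x =>
          G.Adj x κ.2 ∧ (κ.1, x) ∈ m.cur.1).card : ZMod p) ≠ 0} ⊆
          ({κ : I × V | K.delay κ.1 + G.dist (K.loc κ.1) κ.2 = t + 1} ∪ (m.cur.1 : Set (I × V))) ∪
            (m.prev.1 : Set (I × V)) := by
        intro κ hκ
        have h1 := (hx κ).1 hκ
        have h2 := mem_next_frontier hK t κ
        simp only [Set.mem_union, Set.mem_ofPred_eq, Finset.mem_coe, hm.mem_cur, hm.mem_prev]
        by_contra hc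
        exact hc (Or.inl (Or.inl (h2.1 (Or.inr ⟨h1, fun h => hc (Or.inl (Or.inr h)),
          fun h => hc (Or.inr h)⟩))))
      have h1 := hK.frontier_card (t + 1) ht
      have h2 := m.cur.2
      have h3 := m.prev.2
      refine (Set.ncard_le_ncard hsub (Set.toFinite _)).trans ?_
      refine (Set.ncard_union_le _ _).trans ?_
      have h4 := Set.ncard_union_le {κ : I × V | K.delay κ.1 + G.dist (K.loc κ.1) κ.2 = t + 1}
        (m.cur.1 : Set (I × V))
      rw [Set.ncard_coe_finset] at h4 ⊢
      omega
  have hroute := dist_le_routeDist hK.connected hm.dist_le_hop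
  simp only [next, if_pos ht]
  refine ⟨?_, ?_, ?_, ?_, ?_, ?_⟩
  · have h : ∀ κ : I × V, κ ∈ (Finset.univ.filter fun κ : I × V =>
        (K.delay κ.1 = t + 1 ∧ κ.2 = K.loc κ.1) ∨
        (K.decode (graphSum G (K.query t m)).1 κ ≠ 0 ∧ κ ∉ m.cur.1 ∧ κ ∉ m.prev.1)) ↔
        K.delay κ.1 + G.dist (K.loc κ.1) κ.2 = t + 1 := by
      intro κ
      rw [← mem_next_frontier hK t κ]
      simp only [Finset.mem_filter, Finset.mem_univ, true_and, hX, hm.mem_cur, hm.mem_prev]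
    intro κ
    rw [hK.coe_clip_eq (show t + 1 ≤ K.rounds from ht) h]
    exact h κ
  · intro κ
    simp [hm.mem_cur]
  · intro i j
    simp only [hm.mem_cur]
    split_ifs with h
    · rw [Fin.coe_min, val_ofNat_of_le (min_le_right _ _)]
      have h1 := hm.dist_le_hop i j
      have h2 := hK.dist_le (K.loc i) (K.loc j)
      simp only [le_min_iff]
      omega
    · exact hm.dist_le_hop i j
  · intro i j hij
    simp only [hm.mem_cur]
    split_ifs with h
    · rw [Fin.coe_min, val_ofNat_of_le (min_le_right _ _)]
      exact (min_le_right _ _).trans ((min_le_left _ _).trans (by omega))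
    · exact hm.hop_le i j (by omega)
  · intro s v
    have hle : sInf (insert (m.est s v : ℕ) {ℓ | ∃ i, (i, v) ∈ m.cur.1 ∧
        ℓ = routeDist (fun i j => (m.hop i j : ℕ)) (K.terminal s) i + (t - K.delay i)}) ≤ N :=
      (Nat.sInf_le (Set.mem_insert _ _)).trans (Fin.is_le _)
    rw [val_ofNat_of_le hle]
    refine le_csInf (Set.insert_nonempty _ _) ?_
    rintro ℓ (rfl | ⟨i, hi, rfl⟩)
    · exact hm.dist_le_est s v
    · have h1 := (hm.mem_cur (i, v)).1 hi
      have h2 := hroute (K.terminal s) i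
      have h3 := hK.connected.dist_triangle (u := K.loc (K.terminal s)) (v := K.loc i) (w := v)
      simp only at h1
      omega
  · intro s i v hi hv
    have hle : sInf (insert (m.est s v : ℕ) {ℓ | ∃ i, (i, v) ∈ m.cur.1 ∧
        ℓ = routeDist (fun i j => (m.hop i j : ℕ)) (K.terminal s) i + (t - K.delay i)}) ≤ N :=
      (Nat.sInf_le (Set.mem_insert _ _)).trans (Fin.is_le _)
    rw [val_ofNat_of_le hle]
    rcases Nat.lt_succ_iff_lt_or_eq.1 hv with h | h
    · exact (Nat.sInf_le (Set.mem_insert _ _)).trans (hm.est_le s i v hi h)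
    · have h0 : routeDist (fun i j => (m.hop i j : ℕ)) (K.terminal s) i + (t - K.delay i) ∈
          insert (m.est s v : ℕ) {ℓ | ∃ i, (i, v) ∈ m.cur.1 ∧
            ℓ = routeDist (fun i j => (m.hop i j : ℕ)) (K.terminal s) i + (t - K.delay i)} :=
        Set.mem_insert_of_mem _ ⟨i, (hm.mem_cur (i, v)).2 h, rfl⟩
      refine (Nat.sInf_le h0).trans ?_
      -- Since `τ ≤ K.delay i ≤ t`, all hops found before `τ` are already in the table.
      have h1 := hK.routeDist_le _ hm.dist_le_hop (fun i' j hij => hm.hop_le i' j (by omega)) s i hi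
      omega

/-! ### Finding the parents bit by bit -/

/-- What holds when the first `j` bits of all parents are known. -/
structure ParentInvariant (K : Config V I C p B J) (G : SimpleGraph V) (j : ℕ)
    (m : State V I C N B J) : Prop where
  est_eq : ∀ s v, (m.est s v : ℕ) = G.dist (K.loc (K.terminal s)) v
  exists_parent : ∀ s w, w ≠ K.loc (K.terminal s) → ∃ x, G.Adj x w ∧
    G.dist (K.loc (K.terminal s)) x + 1 = G.dist (K.loc (K.terminal s)) w ∧
    ∀ i : Fin J, (i : ℕ) < j → K.code x i = m.bits s w i

/-- The upper bound through a source on a shortest path meets the lower bound, so the estimates are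
exact. With no bits fixed, any penultimate node of a shortest path is a parent. -/
theorem SearchInvariant.parentInvariant (hK : K.IsValid G N τ) {m : State V I C N B J}
    (hm : K.SearchInvariant G τ K.rounds m) : K.ParentInvariant G 0 m where
  est_eq := fun s v => by
    obtain ⟨i, hi, hiv, hs⟩ := hK.exists_source s v
    have h1 := hm.est_le s i v hi hiv
    have h2 := hm.dist_le_est s v
    omega
  exists_parent := fun s w hw => by
    have hpos := hK.connected.pos_dist_of_ne hw.symm
    obtain ⟨x, hx1, hx2⟩ := SteinerGraph.exists_dist_split hK.connected (K.loc (K.terminal s)) w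
      (j := G.dist (K.loc (K.terminal s)) w - 1) (by omega)
    exact ⟨x, dist_eq_one_iff_adj.1 (by omega), by omega, by simp⟩

/-- If some remaining candidate has the next bit set, the bit becomes 1; otherwise every remaining
candidate has 0 there. In both cases the longer prefix still belongs to a true parent. -/
theorem parentInvariant_next [Fintype I] (hK : K.IsValid G N τ) {j : ℕ} (hj : j < J) {m : State V I C N B J}
    (hm : K.ParentInvariant G j m) :
    K.ParentInvariant G (j + 1)
      (K.next (K.rounds + j) m (graphSum G (K.query (K.rounds + j) m))) := by
  classical
  have ht : ¬ K.rounds + j < K.rounds := by omega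
  have hne : ∀ s w, (graphSum G (K.query (K.rounds + j) m)).2 s w ≠ 0 ↔
      ∃ x, G.Adj x w ∧ K.IsCandidate m j s x w := fun s w => by
    rw [graphSum_query_of_not_lt K ht, natCast_card_ne_zero_iff hK.card_lt]
    simp
  refine ⟨?_, ?_⟩
  · simp only [next, if_neg ht]
    exact hm.est_eq
  · intro s w hw
    have hbits : ∀ i : Fin J, (K.next (K.rounds + j) m
        (graphSum G (K.query (K.rounds + j) m))).bits s w i = if (i : ℕ) = j then
        decide (∃ x, G.Adj x w ∧ K.IsCandidate m j s x w) else m.bits s w i := fun i => by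
      simp only [next, if_neg ht, Nat.add_sub_cancel_left, hne]
    have hstep : ∃ x, G.Adj x w ∧ G.dist (K.loc (K.terminal s)) x + 1 =
        G.dist (K.loc (K.terminal s)) w ∧ (∀ i : Fin J, (i : ℕ) < j → K.code x i = m.bits s w i) ∧
        K.code x ⟨j, hj⟩ = decide (∃ x, G.Adj x w ∧ K.IsCandidate m j s x w) := by
      by_cases hex : ∃ x, G.Adj x w ∧ K.IsCandidate m j s x w
      · obtain ⟨x, hx, hx1, hx2, _, hx3⟩ := id hex
        rw [hm.est_eq, hm.est_eq] at hx1
        exact ⟨x, hx, hx1, hx2, by rw [hx3, decide_eq_true hex]⟩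
      · obtain ⟨x, hx, hx1, hx2⟩ := hm.exists_parent s w hw
        refine ⟨x, hx, hx1, hx2, ?_⟩
        rw [decide_eq_false hex]
        by_contra hc
        exact hex ⟨x, hx, by rw [hm.est_eq, hm.est_eq]; exact hx1, hx2, hj, by simpa using hc⟩
    obtain ⟨x, hx, hx1, hx2, hx3⟩ := hstep
    refine ⟨x, hx, hx1, fun i hi => ?_⟩
    rw [hbits]
    split_ifs with hij
    · rw [← hx3]; congr 1; exact Fin.ext hij
    · exact hx2 i (by omega)

theorem parentInvariant_stateAfter [Fintype I] (hK : K.IsValid G N τ) :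
    K.ParentInvariant (N := N) G J (stateAfter G K.query K.next K.start (K.rounds + J)) := by
  have h1 : ∀ t ≤ K.rounds,
      K.SearchInvariant (N := N) G τ t (stateAfter G K.query K.next K.start t) := by
    intro t
    induction t with
    | zero => intro _; exact searchInvariant_start hK
    | succ t ih => intro ht; exact searchInvariant_next hK ht (ih (by omega))
  have h2 : ∀ j ≤ J, K.ParentInvariant (N := N) G j
      (stateAfter G K.query K.next K.start (K.rounds + j)) := by
    intro j
    induction j with
    | zero => intro _; exact (h1 _ le_rfl).parentInvariant hK
    | succ j ih => intro hj; exact parentInvariant_next hK hj (ih (by omega))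
  exact h2 J le_rfl

/-- The graph of all edges between nodes and their parents. -/
def parentGraph (K : Config V I C p B J) (m : State V I C N B J) : SimpleGraph V :=
  SimpleGraph.fromRel fun x w => ∃ s, (m.est s x : ℕ) + 1 = m.est s w ∧ K.code x = m.bits s w

open Classical in
/-- A shortest Steiner tree in the graph of the parents. -/
noncomputable def output (K : Config V I C p B J) (S : Finset V) (m : State V I C N B J) :
    PartialGraph V :=
  if h : ∃ T, IsSteinerTree (K.parentGraph m) S T ∧
      ∀ T', IsSteinerTree (K.parentGraph m) S T' → T.edgeSet.ncard ≤ T'.edgeSet.ncard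
  then h.choose else ⊥

theorem isTwoApproxSteinerTree_output (hK : K.IsValid G N τ) {S : Finset V} (hS : S.Nonempty)
    (hterm : ∀ v ∈ S, ∃ s, K.loc (K.terminal s) = v) {m : State V I C N B J}
    (hm : K.ParentInvariant G J m) : IsTwoApproxSteinerTree G S (K.output S m) := by
  have hpar : ∀ s w, w ≠ K.loc (K.terminal s) → ∃ x, G.Adj x w ∧
      G.dist (K.loc (K.terminal s)) x + 1 = G.dist (K.loc (K.terminal s)) w ∧
      K.code x = m.bits s w := fun s w hw => by
    obtain ⟨x, hx, hx1, hx2⟩ := hm.exists_parent s w hw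
    exact ⟨x, hx, hx1, funext fun i => hx2 i i.2⟩
  have hadj : ∀ x w, (∃ s, (m.est s x : ℕ) + 1 = m.est s w ∧ K.code x = m.bits s w) →
      G.Adj x w := by
    rintro x w ⟨s, hs, hb⟩
    rw [hm.est_eq, hm.est_eq] at hs
    -- The bits stored for the terminal itself name no parent, but its distance 0 is the successor
    -- of no number.
    have hw : w ≠ K.loc (K.terminal s) := by
      rintro rfl
      rw [dist_self] at hs
      omega
    obtain ⟨x', hx', -, hb'⟩ := hpar s w hw
    rwa [hK.code_injective (hb.trans hb'.symm)]
  have hle : K.parentGraph m ≤ G := by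
    intro x w h
    rcases h.2 with h | h
    · exact hadj x w h
    · exact (hadj w x h).symm
  have hwalk : ∀ v ∈ S, ∀ w, ∃ q : (K.parentGraph m).Walk v w, q.length = G.dist v w := by
    intro v hv w
    obtain ⟨s, rfl⟩ := hterm v hv
    induction hd : G.dist (K.loc (K.terminal s)) w generalizing w with
    | zero =>
      have := hK.connected.dist_eq_zero_iff.1 hd
      subst this
      exact ⟨Walk.nil, rfl⟩
    | succ d ih =>
      have hw : w ≠ K.loc (K.terminal s) := by
        rintro rfl
        rw [dist_self] at hd
        omega
      obtain ⟨x, hx, hx1, hb⟩ := hpar s w hw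
      obtain ⟨q, hq⟩ := ih x (by omega)
      have hxw : (K.parentGraph m).Adj x w :=
        ⟨hx.ne, Or.inl ⟨s, by rw [hm.est_eq, hm.est_eq]; exact hx1, hb⟩⟩
      exact ⟨q.concat hxw, by rw [Walk.length_concat, hq]⟩
  obtain ⟨hex, hmin⟩ :=
    SteinerGraph.isTwoApproxSteinerTree_of_minimal hK.connected hle hS hwalk
  have hex' : ∃ T, IsSteinerTree (K.parentGraph m) S T ∧
      ∀ T', IsSteinerTree (K.parentGraph m) S T' → T.edgeSet.ncard ≤ T'.edgeSet.ncard := by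
    let f : PartialGraph V → ℕ := fun T => T.edgeSet.ncard
    exact ⟨Function.argminOn f {T | IsSteinerTree (K.parentGraph m) S T} hex,
      Function.argminOn_mem f {T | IsSteinerTree (K.parentGraph m) S T} hex,
      fun T' hT' => Function.argminOn_le f {T | IsSteinerTree (K.parentGraph m) S T} hT'⟩
  unfold output
  rw [dif_pos hex']
  exact hmin _ hex'.choose_spec.1 hex'.choose_spec.2

end Config

end SteinerStream

/-! ### Random sources and random delays -/

namespace SteinerStream

open LinearSketch SimpleGraph

variable {V : Type} {c k L : ℕ}

/-- The nodes given by an enumeration of the terminals and a list of samples. -/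
def nodeOf (src : Fin c → V) (Z : Fin k → V) : Fin c ⊕ Fin k → V := Sum.elim src Z

/-- The samples meet all shortest paths of length `L`, in a node other than the last. -/
def HitsShortestPaths (G : SimpleGraph V) (L : ℕ) (Z : Fin k → V) : Prop :=
  ∀ w v, G.dist w v = L → ∃ z, Z z ≠ v ∧ G.dist w (Z z) + G.dist (Z z) v = L

/-- With these delays at most `b` of the searches reach a node at the same time. -/
def IsSpread {ι : Type} (G : SimpleGraph V) (L b : ℕ) (loc : ι → V) (x : ι → Fin L) : Prop :=
  ∀ v, ∀ t ≤ 4 * L, {i | (x i : ℕ) + G.dist (loc i) v = t}.ncard ≤ b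

/-- Two searches start from every source: with delays below `L`, and `2 * L` rounds later. -/
def config {p B J : ℕ} (code : V → Fin J → Bool)
    (sketch : ((Bool × (Fin c ⊕ Fin k)) × V → ZMod p) →+ (Fin (2 * (3 * B)) → ZMod p))
    (decode : (Fin (2 * (3 * B)) → ZMod p) → (Bool × (Fin c ⊕ Fin k)) × V → ZMod p)
    (θ : (Fin c → V) × (Fin k → V) × (Fin c ⊕ Fin k → Fin L)) :
    Config V (Bool × (Fin c ⊕ Fin k)) (Fin c) p B J where
  rounds := 4 * L
  loc := fun i => nodeOf θ.1 θ.2.1 i.2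
  delay := fun i => (if i.1 then 2 * L else 0) + θ.2.2 i.2
  terminal := fun s => (false, Sum.inl s)
  code := code
  sketch := sketch
  decode := decode

/-- Beyond distance `L`, the last stretch of length `L` of a shortest path contains a sample. It
differs from the endpoint, so it is strictly closer to the terminal and the induction applies to it;
one short hop completes the route. -/
theorem routeDist_le_dist {G : SimpleGraph V} (hG : G.Connected) (src : Fin c → V)
    {Z : Fin k → V} (hL : 0 < L) (hZ : HitsShortestPaths G L Z)
    (T : Bool × (Fin c ⊕ Fin k) → Bool × (Fin c ⊕ Fin k) → ℕ)
    (hT : ∀ i j, G.dist (nodeOf src Z i) (nodeOf src Z j.2) ≤ L →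
      T (false, i) j ≤ G.dist (nodeOf src Z i) (nodeOf src Z j.2)) (s : Fin c)
    (j : Bool × (Fin c ⊕ Fin k)) :
    routeDist T (false, Sum.inl s) j ≤ G.dist (src s) (nodeOf src Z j.2) := by
  induction hd : G.dist (src s) (nodeOf src Z j.2) using Nat.strong_induction_on generalizing j with
  | _ d ih =>
    subst hd
    by_cases h : G.dist (src s) (nodeOf src Z j.2) ≤ L
    · exact (routeDist_le _ _ _).trans (hT (Sum.inl s) j h)
    · obtain ⟨w, hw1, hw2⟩ := SteinerGraph.exists_dist_split hG (src s) (nodeOf src Z j.2)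
        (j := G.dist (src s) (nodeOf src Z j.2) - L) (by omega)
      obtain ⟨z, hz1, hz2⟩ := hZ w (nodeOf src Z j.2) (by omega)
      have h1 := hG.pos_dist_of_ne hz1
      have h2 := hG.dist_triangle (u := src s) (v := w) (w := Z z)
      have h3 : routeDist T (false, Sum.inl s) (false, Sum.inr z) ≤ G.dist (src s) (Z z) :=
        ih _ (show G.dist (src s) (Z z) < _ by omega) (false, Sum.inr z) rfl
      have h4 : T (false, Sum.inr z) j ≤ G.dist (Z z) (nodeOf src Z j.2) :=
        hT (Sum.inr z) j (show G.dist (Z z) (nodeOf src Z j.2) ≤ L by omega)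
      have h5 := routeDist_le_add T (false, Sum.inl s) (false, Sum.inr z) j
      omega

theorem exists_near_source {G : SimpleGraph V} (hG : G.Connected) (src : Fin c → V)
    {Z : Fin k → V} (hZ : HitsShortestPaths G L Z) (s : Fin c) (v : V) :
    ∃ i, G.dist (nodeOf src Z i) v ≤ L ∧
      G.dist (src s) (nodeOf src Z i) + G.dist (nodeOf src Z i) v = G.dist (src s) v := by
  by_cases h : G.dist (src s) v ≤ L
  · exact ⟨Sum.inl s, by simpa [nodeOf] using h, by simp [nodeOf]⟩
  · obtain ⟨w, hw1, hw2⟩ := SteinerGraph.exists_dist_split hG (src s) v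
      (j := G.dist (src s) v - L) (by omega)
    obtain ⟨z, -, hz2⟩ := hZ w v (by omega)
    have h1 := hG.dist_triangle (u := src s) (v := w) (w := Z z)
    have h2 := hG.dist_triangle (u := src s) (v := Z z) (w := v)
    exact ⟨Sum.inr z, by simp only [nodeOf, Sum.elim_inr]; omega,
      by simp only [nodeOf, Sum.elim_inr]; omega⟩

/-- A search of the first kind starts before `L` and finds all sources within distance `L` before `2
* L`. One of the second kind starts in `[2 * L, 3 * L)` and covers distance `L` before `4 * L`. The
two kinds account for `2 * b` searches per node and round. -/
theorem isValid_config [Fintype V] [DecidableEq V] {p b J : ℕ} {code : V → Fin J → Bool}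
    (hcode : Function.Injective code)
    {sketch : ((Bool × (Fin c ⊕ Fin k)) × V → ZMod p) →+
      (Fin (2 * (3 * (Fintype.card V * (2 * b)))) → ZMod p)}
    {decode : (Fin (2 * (3 * (Fintype.card V * (2 * b)))) → ZMod p) →
      (Bool × (Fin c ⊕ Fin k)) × V → ZMod p}
    (hp : Fintype.card V < p)
    (hdec : ∀ x, {κ | x κ ≠ 0}.ncard ≤ 3 * (Fintype.card V * (2 * b)) → decode (sketch x) = x)
    {θ : (Fin c → V) × (Fin k → V) × (Fin c ⊕ Fin k → Fin L)} (hL : 0 < L)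
    {G : SimpleGraph V} (hG : G.Connected) (hZ : HitsShortestPaths G L θ.2.1)
    (hx : IsSpread G L b (nodeOf θ.1 θ.2.1) θ.2.2) :
    (config code sketch decode θ).IsValid G (Fintype.card V) (2 * L) where
  connected := hG
  card_le := le_rfl
  card_lt := hp
  code_injective := hcode
  decode_sketch := hdec
  frontier_card := by
    classical
    intro t ht
    let F : V → ℕ → Finset (Fin c ⊕ Fin k) := fun v t =>
      Finset.univ.filter fun i => (θ.2.2 i : ℕ) + G.dist (nodeOf θ.1 θ.2.1 i) v = t
    have hF : ∀ v, ∀ t ≤ 4 * L, (F v t).card ≤ b := fun v t ht => by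
      have := hx v t ht
      rwa [Set.ncard_eq_toFinset_card', Set.toFinset_ofPred] at this
    let E : Finset ((Bool × (Fin c ⊕ Fin k)) × V) := Finset.univ.biUnion fun v =>
      (F v t).image (fun i => ((false, i), v)) ∪ (F v (t - 2 * L)).image (fun i => ((true, i), v))
    have hE : E.card ≤ Fintype.card V * (2 * b) := by
      refine Finset.card_biUnion_le.trans ?_
      refine (Finset.sum_le_card_nsmul _ _ (2 * b) fun v _ => ?_).trans_eq (by simp)
      refine (Finset.card_union_le _ _).trans ?_
      have h1 := (Finset.card_image_le (s := F v t)
        (f := fun i => ((false, i), v))).trans (hF v t ht)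
      have h2 := (Finset.card_image_le (s := F v (t - 2 * L))
        (f := fun i => ((true, i), v))).trans (hF v (t - 2 * L) ((Nat.sub_le _ _).trans ht))
      omega
    refine le_trans ?_ hE
    rw [← Set.ncard_coe_finset]
    refine Set.ncard_le_ncard ?_ (Set.toFinite _)
    rintro ⟨⟨β, i⟩, v⟩ hκ
    cases β
    · refine Finset.mem_biUnion.2 ⟨v, Finset.mem_univ _, Finset.mem_union_left _
        (Finset.mem_image.2 ⟨i, ?_, rfl⟩)⟩
      simpa [config, F] using hκ
    · refine Finset.mem_biUnion.2 ⟨v, Finset.mem_univ _, Finset.mem_union_right _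
        (Finset.mem_image.2 ⟨i, ?_, rfl⟩)⟩
      simp only [config, Set.mem_ofPred_eq, if_true] at hκ
      simp only [F, Finset.mem_filter, Finset.mem_univ, true_and]
      omega
  routeDist_le := by
    intro T _ hT s i _
    refine routeDist_le_dist hG θ.1 hL hZ T (fun i j hij => ?_) s i
    have h1 := hT (false, i) j
    have h2 := (θ.2.2 i).2
    simp only [config, Bool.false_eq_true, if_false] at h1
    exact h1 (by omega)
  exists_source := by
    intro s v
    obtain ⟨i, hi, hs⟩ := exists_near_source hG θ.1 hZ s v
    have h2 := (θ.2.2 i).2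
    refine ⟨(true, i), ?_, ?_, hs⟩
    · simp [config]
    · simp only [config, if_true]
      omega

/-- The union bound in terms of cardinalities, with failure probability `1 / M`. -/
theorem card_biUnion_mul_le {Ω β : Type} [DecidableEq Ω] [Fintype β] [Nonempty β] (bad : β → Finset Ω) (M W : ℕ)
    (h : ∀ i, (bad i).card * (Fintype.card β * M) ≤ W) :
    (Finset.univ.biUnion bad).card * M ≤ W := by
  have h1 : (∑ i, (bad i).card) * (Fintype.card β * M) ≤ Fintype.card β * W := by
    rw [Finset.sum_mul, ← smul_eq_mul (Fintype.card β) W]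
    exact Finset.sum_le_card_nsmul _ _ _ fun i _ => h i
  have h2 : Fintype.card β * ((∑ i, (bad i).card) * M) ≤ Fintype.card β * W := by
    calc _ = (∑ i, (bad i).card) * (Fintype.card β * M) := by ring
      _ ≤ _ := h1
  exact (Nat.mul_le_mul_right _ Finset.card_biUnion_le).trans
    (Nat.le_of_mul_le_mul_left h2 Fintype.card_pos)

open Classical in
/-- Most seeds hit all shortest paths and spread the searches. -/
theorem card_bad_seeds_mul_le [Fintype V] [Nonempty V] {G : SimpleGraph V} (hG : G.Connected)
    (src : Fin c → V) (M ℓ b : ℕ) (hL : 0 < L) (hk : Fintype.card V * ℓ ≤ L * k)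
    (hℓ : 2 * M * Fintype.card V ^ 2 ≤ 2 ^ ℓ)
    (hb : 2 * M * (Fintype.card V * (4 * L + 1)) * 4 ^ ((c + k) / L + 1) ≤ 2 ^ b) :
    (Finset.univ.filter fun ω : (Fin k → V) × (Fin c ⊕ Fin k → Fin L) =>
      ¬ (HitsShortestPaths G L ω.1 ∧ IsSpread G L b (nodeOf src ω.1) ω.2)).card * M ≤
      Fintype.card ((Fin k → V) × (Fin c ⊕ Fin k → Fin L)) := by
  set W := Fintype.card ((Fin k → V) × (Fin c ⊕ Fin k → Fin L)) with hW
  have hWeq : W = Fintype.card V ^ k * L ^ (c + k) := by simp [hW]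
  let bad₁ : V × V → Finset ((Fin k → V) × (Fin c ⊕ Fin k → Fin L)) := fun q =>
    Finset.univ.filter fun ω => G.dist q.1 q.2 = L ∧
      ∀ z, ω.1 z ∉ Finset.univ.filter fun x => x ≠ q.2 ∧ G.dist q.1 x + G.dist x q.2 = L
  let bad₂ : V × Fin (4 * L + 1) → Finset ((Fin k → V) × (Fin c ⊕ Fin k → Fin L)) := fun q =>
    Finset.univ.filter fun ω => b ≤ (Finset.univ.filter fun i =>
      (ω.2 i : ℕ) + G.dist (nodeOf src ω.1 i) q.1 = q.2).card
  -- Each of the two kinds of failure is allotted probability `1 / (2 * M)`.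
  have h₁ : (Finset.univ.biUnion bad₁).card * (2 * M) ≤ W := by
    refine card_biUnion_mul_le bad₁ _ _ fun q => ?_
    by_cases hq : G.dist q.1 q.2 = L
    -- A shortest path of length `L` has one node at each distance below `L`; these omit its
    -- endpoint.
    · have hgood : L ≤ (Finset.univ.filter fun x =>
          x ≠ q.2 ∧ G.dist q.1 x + G.dist x q.2 = L).card := by
        have hex : ∀ j : Fin L, ∃ x, G.dist q.1 x = j ∧
            G.dist q.1 x + G.dist x q.2 = G.dist q.1 q.2 :=
          fun j => SteinerGraph.exists_dist_split hG q.1 q.2 (by omega)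
        choose f hf1 hf2 using hex
        have hinj : Function.Injective f := fun i j hij => by
          have h1 := hf1 i
          rw [hij, hf1 j] at h1
          exact (Fin.ext h1).symm
        calc L = (Finset.univ.image f).card := by
              rw [Finset.card_image_of_injective _ hinj]; simp
          _ ≤ _ := by
              refine Finset.card_le_card fun x hx => ?_
              obtain ⟨j, -, rfl⟩ := Finset.mem_image.1 hx
              rw [Finset.mem_filter]
              refine ⟨Finset.mem_univ _, fun h => ?_, by rw [hf2, hq]⟩
              have := hf1 j
              rw [h, hq] at this
              omega
      have h1 := TailBound.card_missing_mul_le L k ℓ _ hgood hk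
      have h2 : bad₁ q = (Finset.univ.filter fun Z : Fin k → V => ∀ z, Z z ∉
          Finset.univ.filter fun x => x ≠ q.2 ∧ G.dist q.1 x + G.dist x q.2 = L) ×ˢ
          Finset.univ := by
        ext ω
        simp [bad₁, hq]
      rw [h2, Finset.card_product, hWeq]
      have h3 : (Finset.univ : Finset (Fin c ⊕ Fin k → Fin L)).card = L ^ (c + k) := by simp
      have h4 : Fintype.card (V × V) = Fintype.card V ^ 2 := by simp [sq]
      rw [h3, h4]
      calc _ = (Finset.univ.filter fun Z : Fin k → V => ∀ z, Z z ∉ Finset.univ.filter fun x =>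
              x ≠ q.2 ∧ G.dist q.1 x + G.dist x q.2 = L).card *
              (2 * M * Fintype.card V ^ 2) * L ^ (c + k) := by ring
        _ ≤ _ := Nat.mul_le_mul_right _ ((Nat.mul_le_mul_left _ hℓ).trans h1)
    · simp [bad₁, hq]
  have h₂ : (Finset.univ.biUnion bad₂).card * (2 * M) ≤ W := by
    refine card_biUnion_mul_le bad₂ _ _ fun q => ?_
    -- The delays are independent of the samples, so the tail bound applies for every fixed `Z`.
    have h1 : (bad₂ q).card * 2 ^ b ≤ W * 4 ^ ((c + k) / L + 1) := by
      have h2 : (bad₂ q).card = ∑ Z : Fin k → V, (Finset.univ.filter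
          fun x : Fin c ⊕ Fin k → Fin L => b ≤ (Finset.univ.filter fun i =>
            (x i : ℕ) + G.dist (nodeOf src Z i) q.1 = q.2).card).card := by
        simp only [bad₂, Finset.card_filter, Fintype.sum_prod_type]
      rw [h2, Finset.sum_mul, hWeq, mul_assoc]
      refine (Finset.sum_le_card_nsmul _ _ (L ^ (c + k) * 4 ^ ((c + k) / L + 1))
        fun Z _ => ?_).trans_eq (by simp)
      have h4 := TailBound.card_many_coincidences_mul_le L b hL
        (fun i => G.dist (nodeOf src Z i) q.1) q.2
      simpa using h4
    have h5 : Fintype.card (V × Fin (4 * L + 1)) = Fintype.card V * (4 * L + 1) := by simp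
    rw [h5]
    have h6 : (bad₂ q).card * (Fintype.card V * (4 * L + 1) * (2 * M)) *
        4 ^ ((c + k) / L + 1) ≤ W * 4 ^ ((c + k) / L + 1) := by
      refine le_trans ?_ h1
      rw [mul_assoc]
      refine Nat.mul_le_mul_left _ (le_trans (le_of_eq ?_) hb)
      ring
    exact Nat.le_of_mul_le_mul_right h6 (by positivity)
  have hsub : (Finset.univ.filter fun ω : (Fin k → V) × (Fin c ⊕ Fin k → Fin L) =>
      ¬ (HitsShortestPaths G L ω.1 ∧ IsSpread G L b (nodeOf src ω.1) ω.2)) ⊆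
      Finset.univ.biUnion bad₁ ∪ Finset.univ.biUnion bad₂ := by
    intro ω hω
    by_contra hn
    simp only [Finset.mem_union, Finset.mem_biUnion, Finset.mem_univ, true_and, not_or,
      not_exists] at hn
    refine (Finset.mem_filter.1 hω).2 ⟨fun w v hwv => ?_, fun v t ht => ?_⟩
    · by_contra! hz
      refine hn.1 (w, v) ?_
      simp only [bad₁, Finset.mem_filter, Finset.mem_univ, true_and]
      exact ⟨hwv, fun z hz' => hz z hz'.1 hz'.2⟩
    · have h1 := hn.2 (v, ⟨t, by omega⟩)
      simp only [bad₂, Finset.mem_filter, Finset.mem_univ, true_and, not_le] at h1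
      rw [Set.ncard_eq_toFinset_card', Set.toFinset_ofPred]
      convert h1.le
  have h3 := (Finset.card_le_card hsub).trans (Finset.card_union_le _ _)
  nlinarith [Nat.mul_le_mul_right (2 * M) h3]

end SteinerStream

/-! ### Space, success probability and the choice of parameters -/

namespace SteinerStream

open LinearSketch SimpleGraph

theorem ofReal_le_toOuterMeasure_uniform {Ω : Type} [Fintype Ω] [Nonempty Ω] (A : Set Ω)
    (bad : Finset Ω) (hA : ∀ ω ∉ bad, ω ∈ A) (M : ℕ) (hM : 0 < M)
    (h : bad.card * M ≤ Fintype.card Ω) :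
    ENNReal.ofReal (1 - 1 / (M : ℝ)) ≤ (PMF.uniformOfFintype Ω).toOuterMeasure A := by
  classical
  rw [PMF.toOuterMeasure_uniformOfFintype_apply]
  have hΩ : (0 : ℝ) < Fintype.card Ω := by exact_mod_cast Fintype.card_pos
  have h1 : ((Fintype.card A : ℕ) : ENNReal) / (Fintype.card Ω : ℕ) =
      ENNReal.ofReal ((Fintype.card A : ℝ) / Fintype.card Ω) := by
    rw [ENNReal.ofReal_div_of_pos hΩ, ENNReal.ofReal_natCast, ENNReal.ofReal_natCast]
  rw [h1]
  apply ENNReal.ofReal_le_ofReal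
  have h2 : badᶜ.card ≤ Fintype.card A := by
    rw [← Set.toFinset_card]
    refine Finset.card_le_card fun ω hω => ?_
    rw [Set.mem_toFinset]
    exact hA ω (Finset.mem_compl.1 hω)
  have h3 : badᶜ.card + bad.card = Fintype.card Ω := Finset.card_compl_add_card bad
  have h4 : (Fintype.card Ω : ℝ) ≤ Fintype.card A + bad.card := by exact_mod_cast (by omega)
  have h5 : (bad.card : ℝ) * M ≤ Fintype.card Ω := by exact_mod_cast h
  have hM' : (0 : ℝ) < M := by exact_mod_cast hM
  rw [le_div_iff₀ hΩ, sub_mul, one_mul, one_div_mul_eq_div]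
  have h6 : (bad.card : ℝ) ≤ Fintype.card Ω / M := by rwa [le_div_iff₀ hM']
  linarith

/-- A small set is encoded as a list of length `B`, padded with `none`; its cost is `B` names of
elements instead of one bit per element of `κ`. -/
theorem card_boundedFinset_le {B : ℕ} (κ : Type) [Fintype κ] [Fintype (BoundedFinset κ B)] :
    Fintype.card (BoundedFinset κ B) ≤ (Fintype.card κ + 1) ^ B := by
  have h : Function.Injective fun (F : BoundedFinset κ B) (i : Fin B) => F.1.toList[(i : ℕ)]? := by
    have key : ∀ (F F' : BoundedFinset κ B),
        (fun i : Fin B => F.1.toList[(i : ℕ)]?) = (fun i : Fin B => F'.1.toList[(i : ℕ)]?) →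
        F.1 ⊆ F'.1 := by
      intro F F' hFF x hx
      rw [← Finset.mem_toList] at hx ⊢
      obtain ⟨i, hi⟩ := List.mem_iff_getElem?.1 hx
      have hlt : i < F.1.toList.length := by
        by_contra hge
        rw [List.getElem?_eq_none (by omega)] at hi
        simp at hi
      rw [Finset.length_toList] at hlt
      have := congrFun hFF ⟨i, hlt.trans_le F.2⟩
      simp only at this
      exact List.mem_iff_getElem?.2 ⟨i, by rw [← this, hi]⟩
    intro F F' hFF
    exact Subtype.ext (Finset.Subset.antisymm (key F F' hFF) (key F' F hFF.symm))
  refine (Fintype.card_le_of_injective _ h).trans_eq ?_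
  simp

/-- The components of a state. -/
def State.equivProd (V I C : Type) (N B J : ℕ) : State V I C N B J ≃
    BoundedFinset (I × V) B × BoundedFinset (I × V) B × (I → I → Fin (N + 1)) ×
      (C → V → Fin (N + 1)) × (C → V → Fin J → Bool) where
  toFun m := (m.cur, m.prev, m.hop, m.est, m.bits)
  invFun m := ⟨m.1, m.2.1, m.2.2.1, m.2.2.2.1, m.2.2.2.2⟩
  left_inv _ := rfl
  right_inv _ := rfl

noncomputable instance State.fintype {V I C : Type} [Fintype V] [Fintype I] [Fintype C]
    {N B J : ℕ} : Fintype (State V I C N B J) := by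
  classical
  exact Fintype.ofEquiv _ (State.equivProd V I C N B J).symm

theorem State.card_le (V I C : Type) [Fintype V] [Fintype I] [Fintype C] (N B J : ℕ) :
    Fintype.card (State V I C N B J) ≤ (Fintype.card I * Fintype.card V + 1) ^ (2 * B) *
      (N + 1) ^ (Fintype.card I ^ 2 + Fintype.card C * Fintype.card V) *
      2 ^ (Fintype.card C * Fintype.card V * J) := by
  classical
  rw [Fintype.card_congr (State.equivProd V I C N B J)]
  have h := card_boundedFinset_le (B := B) (I × V)
  rw [Fintype.card_prod I V] at h
  simp only [Fintype.card_prod, Fintype.card_fun, Fintype.card_fin, Fintype.card_bool]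
  rw [← pow_mul, ← pow_mul, ← pow_mul, ← pow_mul]
  calc _ ≤ (Fintype.card I * Fintype.card V + 1) ^ B * ((Fintype.card I * Fintype.card V + 1) ^ B *
        ((N + 1) ^ (Fintype.card I * Fintype.card I) *
          ((N + 1) ^ (Fintype.card V * Fintype.card C) *
            2 ^ (J * (Fintype.card V * Fintype.card C))))) := by
        gcongr
    _ = _ := by ring

/-- `hk` and `hℓ` make the samples hit, `hb` spreads the searches, `hJ` provides names of nodes,
`hnp` keeps counts nonzero modulo `p`, `hp` supplies distinct evaluation points, and `hs` fits
everything into memory. -/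
theorem exists_steiner_algorithm {n c k L ℓ b J p M s : ℕ} [Fact p.Prime] (hn : 0 < n)
    (hc : 0 < c) (hL : 0 < L) (hM : 0 < M) (hk : n * ℓ ≤ L * k) (hℓ : 2 * M * n ^ 2 ≤ 2 ^ ℓ)
    (hb : 2 * M * (n * (4 * L + 1)) * 4 ^ ((c + k) / L + 1) ≤ 2 ^ b) (hJ : n ≤ 2 ^ J)
    (hnp : n < p) (hp : 2 * (c + k) * n ≤ p)
    (hs : (n ^ (c + k) * L ^ (c + k)) *
      ((2 * (c + k) * n + 1) ^ (2 * (n * (2 * b))) *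
        (n + 1) ^ ((2 * (c + k)) ^ 2 + c * n) * 2 ^ (c * n * J)) *
      (4 * L + J + 1) * p ^ (2 * (3 * (n * (2 * b))) + c * n) ≤ 2 ^ s) :
    ∃ A : StreamingAlgorithm (Finset (Fin n)) (EdgeUpdate (Fin n)) (PartialGraph (Fin n)) s,
      ∀ G : SimpleGraph (Fin n), G.Connected → ∀ S : Finset (Fin n), S.card = c →
      ∀ σ : List (EdgeUpdate (Fin n)), IsTurnstileStream G σ →
        ENNReal.ofReal (1 - 1 / (M : ℝ)) ≤
          (A.run (4 * L + J) S σ).toOuterMeasure {T | IsTwoApproxSteinerTree G S T} := by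
  classical
  have : NeZero n := ⟨hn.ne'⟩
  have : NeZero L := ⟨hL.ne'⟩
  let V := Fin n
  have hV : Fintype.card V = n := Fintype.card_fin n
  let I := Bool × (Fin c ⊕ Fin k)
  have hI : Fintype.card I = 2 * (c + k) := by simp [I]
  let B := Fintype.card V * (2 * b)
  have hB : B = n * (2 * b) := by simp [B, hV]
  obtain ⟨code⟩ : Nonempty (V ↪ (Fin J → Bool)) :=
    Function.Embedding.nonempty_of_card_le (by simpa [V] using hJ)
  obtain ⟨sketch, decode, hdec⟩ := SparseRecovery.exists_sketch (κ := I × V) p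
    (by rw [Fintype.card_prod, hI, hV]; exact hp) (3 * B)
  let Ω := (Fin k → V) × (Fin c ⊕ Fin k → Fin L)
  let Θ := (Fin c → V) × Ω
  let src : Finset V → Fin c → V := fun S =>
    if h : S.card = c then S.orderEmbOfFin h else fun _ => 0
  let cfg : Θ → Config V I (Fin c) p B J := fun θ => config code sketch decode θ
  have hcard : Fintype.card Θ * Fintype.card (State V I (Fin c) n B J) * (4 * L + J + 1) *
      Fintype.card (Answer V (Fin c) p B) ≤ 2 ^ s := by
    refine le_trans ?_ hs
    have h1 : Fintype.card Θ = n ^ (c + k) * L ^ (c + k) := by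
      simp [Θ, Ω, V, pow_add]; ring
    have h2 : Fintype.card (Answer V (Fin c) p B) = p ^ (2 * (3 * (n * (2 * b))) + c * n) := by
      rw [← hB]
      simp only [Answer, V, Fintype.card_prod, Fintype.card_fun, ZMod.card, Fintype.card_fin]
      rw [pow_add, ← pow_mul, mul_comm n c]
    have h3 := State.card_le V I (Fin c) n B J
    rw [hI, hV, hB, Fintype.card_fin] at h3
    rw [h1, h2]
    gcongr
    rw [hB]
    exact h3
  obtain ⟨A, hA⟩ := exists_streamingAlgorithm (4 * L + J) s hcard
    (fun (S : Finset V) (ω : Ω) => ((src S, ω) : Θ)) (fun θ => (cfg θ).start)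
    (fun θ => (cfg θ).query) (fun θ => (cfg θ).next)
    (fun θ m => (cfg θ).output (Finset.univ.image θ.1) m)
  refine ⟨A, fun G hG S hS σ hσ => ?_⟩
  rw [hA G σ hσ S, PMF.toOuterMeasure_map_apply]
  have himage : Finset.univ.image (src S) = S := by
    ext v
    simp [src, hS]
  have hbad := card_bad_seeds_mul_le hG (src S) M ℓ b hL (by rw [hV]; exact hk)
    (by rw [hV]; exact hℓ) (by rw [hV]; exact hb)
  refine ofReal_le_toOuterMeasure_uniform _ _ ?_ M hM hbad
  intro ω hω
  simp only [Finset.mem_filter, Finset.mem_univ, true_and, not_not] at hω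
  have hvalid : (cfg (src S, ω)).IsValid G (Fintype.card V) (2 * L) := by
    refine isValid_config code.injective (by rwa [hV]) (fun x hx => hdec x ?_) hL hG hω.1 hω.2
    rwa [Set.ncard_eq_toFinset_card', Set.toFinset_ofPred] at hx
  have hSne : S.Nonempty := Finset.card_pos.1 (by omega)
  rw [hV] at hvalid
  have hout := Config.isTwoApproxSteinerTree_output hvalid hSne (fun v hv => by
    rw [← himage] at hv
    obtain ⟨s, -, hs⟩ := Finset.mem_image.1 hv
    exact ⟨s, hs⟩) (Config.parentInvariant_stateAfter hvalid)
  simp only [Set.mem_preimage, Set.mem_ofPred_eq]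
  rw [himage]
  exact hout

end SteinerStream

/-- The exponent of two that bounds the size of the memory. -/
theorem SteinerStream.space_exponent_le {n c k L w b b' : ℕ} (hc : 1 ≤ c) (hck : c ≤ k)
    (hnLk : n ≤ L * k) (hb' : 1 ≤ b') (hb : b = 2 * ((c + k) / L + 1) + b') :
    w * (2 * (c + k)) + (w * (2 * (n * (2 * b))) +
      w * ((2 * (c + k)) ^ 2 + c * n) + w * (c * n)) + w +
      w * (2 * (3 * (n * (2 * b))) + c * n) ≤ 200 * (w * b') * (c * n + k ^ 2) := by
  have hk : 1 ≤ k := by omega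
  -- The decisive trade-off: since `n / L ≤ k`, the frontiers cost `k * (c + k)` rather than `n * (c
  -- + k)`.
  have h1 : n * ((c + k) / L) ≤ 2 * k ^ 2 := by
    calc n * ((c + k) / L) ≤ (L * k) * ((c + k) / L) := Nat.mul_le_mul_right _ hnLk
      _ = k * ((c + k) / L * L) := by ring
      _ ≤ k * (c + k) := Nat.mul_le_mul_left _ (Nat.div_mul_le_self _ _)
      _ ≤ k * (k + k) := by gcongr
      _ = 2 * k ^ 2 := by ring
  have h2 : n * b ≤ 4 * k ^ 2 + 2 * (c * n) + (c * n) * b' := by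
    have h3 : n ≤ c * n := Nat.le_mul_of_pos_left _ hc
    have h4 : n * b = 2 * (n * ((c + k) / L)) + 2 * n + n * b' := by rw [hb]; ring
    have h5 : n * b' ≤ (c * n) * b' := Nat.mul_le_mul_right _ h3
    omega
  have h6 : c + k ≤ 2 * k ^ 2 := by nlinarith
  have h7 : (2 * (c + k)) ^ 2 ≤ 16 * k ^ 2 := by
    calc (2 * (c + k)) ^ 2 ≤ (2 * (k + k)) ^ 2 := by gcongr
      _ = _ := by ring
  have h8 : 1 ≤ k ^ 2 := Nat.one_le_pow _ _ hk
  have h10 : 2 * (c + k) + 16 * (n * b) + (2 * (c + k)) ^ 2 + 3 * (c * n) + 1 ≤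
      200 * (c * n * b' + k ^ 2 * b') := by
    have h11 : c * n ≤ c * n * b' := Nat.le_mul_of_pos_right _ hb'
    have h12 : k ^ 2 ≤ k ^ 2 * b' := Nat.le_mul_of_pos_right _ hb'
    have h13 := Nat.zero_le (c * n)
    have h14 := Nat.zero_le (k ^ 2)
    linarith
  calc _ = w * (2 * (c + k) + 16 * (n * b) + (2 * (c + k)) ^ 2 + 3 * (c * n) + 1) := by ring
    _ ≤ w * (200 * (c * n * b' + k ^ 2 * b')) := Nat.mul_le_mul_left _ h10
    _ = _ := by ring

theorem SteinerStream.memory_size_le {n c k L w b g p : ℕ} (hn : n + 1 ≤ 2 ^ w) (hL : L ≤ 2 ^ w)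
    (hκ : 2 * (c + k) * n + 1 ≤ 2 ^ w) (hP : 4 * L + g + 1 ≤ 2 ^ w) (hp : p ≤ 2 ^ w)
    (hg : g ≤ w) :
    (n ^ (c + k) * L ^ (c + k)) *
      ((2 * (c + k) * n + 1) ^ (2 * (n * (2 * b))) *
        (n + 1) ^ ((2 * (c + k)) ^ 2 + c * n) * 2 ^ (c * n * g)) *
      (4 * L + g + 1) * p ^ (2 * (3 * (n * (2 * b))) + c * n) ≤
    2 ^ (w * (2 * (c + k)) + (w * (2 * (n * (2 * b))) +
      w * ((2 * (c + k)) ^ 2 + c * n) + w * (c * n)) + w +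
      w * (2 * (3 * (n * (2 * b))) + c * n)) := by
  have hn' : n ≤ 2 ^ w := by omega
  have e1 : n ^ (c + k) * L ^ (c + k) ≤ 2 ^ (w * (2 * (c + k))) := by
    calc n ^ (c + k) * L ^ (c + k) ≤ (2 ^ w) ^ (c + k) * (2 ^ w) ^ (c + k) :=
          Nat.mul_le_mul (Nat.pow_le_pow_left hn' _) (Nat.pow_le_pow_left hL _)
      _ = _ := by rw [← pow_add, ← pow_mul, two_mul]
  have e2 : 2 ^ (c * n * g) ≤ 2 ^ (w * (c * n)) := by
    rw [mul_comm w]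
    exact Nat.pow_le_pow_right (by norm_num) (Nat.mul_le_mul_left _ hg)
  have e3 : ∀ x m : ℕ, x ≤ 2 ^ w → x ^ m ≤ 2 ^ (w * m) := fun x m hx => by
    rw [pow_mul]
    exact Nat.pow_le_pow_left hx _
  rw [pow_add 2 (_ + _ + w), pow_add 2 (_ + _) w, pow_add 2 (w * (2 * (c + k))),
    pow_add 2 (_ + _) (w * (c * n)), pow_add 2 (w * (2 * (n * (2 * b))))]
  exact Nat.mul_le_mul (Nat.mul_le_mul (Nat.mul_le_mul e1 (Nat.mul_le_mul
    (Nat.mul_le_mul (e3 _ _ hκ) (e3 _ _ hn)) e2)) hP) (e3 _ _ hp)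

open SteinerStream in
/-- The choice of the parameters, in terms of an upper bound `g` on the binary logarithm of the
number of nodes. -/
theorem SteinerStream.exists_steiner_algorithm_of_clog {n c k d g : ℕ} (hc : 1 ≤ c) (hck : c ≤ k)
    (hkn : k ≤ n) (hg : n + 1 ≤ 2 ^ g) (hgn : g ≤ n) :
    ∃ p s : ℕ, p ≤ (9 * (d + 3)) * ((n / k + 1) * g) ∧
      s ≤ 200 * ((d + 9) * (2 * d + 10)) * ((c * n + k ^ 2) * g ^ 2) ∧
      ∃ A : StreamingAlgorithm (Finset (Fin n)) (EdgeUpdate (Fin n)) (PartialGraph (Fin n)) s,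
        ∀ G : SimpleGraph (Fin n), G.Connected → ∀ S : Finset (Fin n), S.card = c →
        ∀ σ : List (EdgeUpdate (Fin n)), IsTurnstileStream G σ →
          ENNReal.ofReal (1 - 1 / ((n ^ d : ℕ) : ℝ)) ≤
            (A.run p S σ).toOuterMeasure {T | IsTwoApproxSteinerTree G S T} := by
  have hn : 1 ≤ n := by omega
  have hk : 1 ≤ k := by omega
  have hg1 : 1 ≤ g := by
    by_contra h
    have : g = 0 := by omega
    subst this
    simp at hg
    omega
  have h2g : 2 ≤ 2 ^ g := by omega
  have hn2 : n ≤ 2 ^ g := by omega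
  have hd : d + 3 ≤ 2 ^ (g * (d + 3)) :=
    Nat.lt_two_pow_self.le.trans (Nat.pow_le_pow_right (by norm_num) (Nat.le_mul_of_pos_left _ hg1))
  -- With `ℓ = (d + 3) * g`, this gives `n * ℓ ≤ L * k` and `2 * n ^ d * n ^ 2 ≤ 2 ^ ℓ`.
  obtain ⟨L, hL⟩ : ∃ L, L = (n / k + 1) * ((d + 3) * g) := ⟨_, rfl⟩
  -- `b'` pays for the union bound over nodes and rounds; the rest of `b` cancels the power of 4 in
  -- the tail bound.
  obtain ⟨b', hb'⟩ : ∃ b', b' = (2 * d + 10) * g := ⟨_, rfl⟩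
  obtain ⟨b, hb⟩ : ∃ b, b = 2 * ((c + k) / L + 1) + b' := ⟨_, rfl⟩
  -- A word of `w` bits holds any one number in the memory.
  obtain ⟨w, hw⟩ : ∃ w, w = (d + 9) * g := ⟨_, rfl⟩
  have hLpos : 0 < L := by rw [hL]; positivity
  have hnk : n ≤ (n / k + 1) * k := by
    have := Nat.lt_div_mul_add (a := n) hk
    rw [add_mul, one_mul]
    exact this.le
  have hLk : n * ((d + 3) * g) ≤ L * k := by
    calc n * ((d + 3) * g) ≤ (n / k + 1) * k * ((d + 3) * g) := Nat.mul_le_mul_right _ hnk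
      _ = L * k := by rw [hL]; ring
  have hnLk : n ≤ L * k := le_trans (Nat.le_mul_of_pos_right _ (by positivity)) hLk
  have hL2 : L ≤ 2 ^ (g * (d + 5)) := by
    calc L ≤ 2 ^ g * (2 ^ (g * (d + 3)) * 2 ^ g) := by
          rw [hL]
          gcongr
          · exact (Nat.add_le_add_right (Nat.div_le_self n k) 1).trans hg
          · omega
      _ = 2 ^ (g * (d + 5)) := by ring
  have hL8 : 4 * L + 1 ≤ 2 ^ (g * (d + 8)) := by
    calc 4 * L + 1 ≤ 2 * 2 * 2 * L := by omega
      _ ≤ 2 ^ g * 2 ^ g * 2 ^ g * 2 ^ (g * (d + 5)) := by gcongr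
      _ = _ := by ring
  -- The `2 * (c + k) * n ≤ 4 * n ^ 2` pairs of search and node need distinct residues; Bertrand's
  -- postulate keeps `p` polynomial in `n`.
  obtain ⟨p, hp, hp1, hp2⟩ := Nat.exists_prime_lt_and_le_two_mul (4 * (n + 1) ^ 2) (by positivity)
  have : Fact p.Prime := ⟨hp⟩
  have hsq : n * n + n + n + 1 = (n + 1) ^ 2 := by ring
  have hKn : (c + k) * n ≤ 2 * (n * n) := by
    calc (c + k) * n ≤ (n + n) * n := by gcongr; omega
      _ = _ := by ring
  have hbases : ∀ x, x ≤ 2 ^ (g * 5) → x ≤ 2 ^ w := fun x hx =>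
    hx.trans (Nat.pow_le_pow_right (by norm_num) (by rw [hw, mul_comm]; gcongr; omega))
  have hpw : p ≤ 2 ^ w := by
    apply hbases
    calc p ≤ 2 * (2 * 2 * (n + 1) ^ 2) := by omega
      _ ≤ 2 ^ g * (2 ^ g * 2 ^ g * (2 ^ g) ^ 2) := by gcongr
      _ = _ := by ring
  have hLw : L ≤ 2 ^ w :=
    hL2.trans (Nat.pow_le_pow_right (by norm_num) (by rw [hw, mul_comm]; gcongr; omega))
  have hPw : 4 * L + g + 1 ≤ 2 ^ w := by
    have h1 : g ≤ 2 ^ (g * (d + 8)) :=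
      hgn.trans (hn2.trans (Nat.pow_le_pow_right (by norm_num) (Nat.le_mul_of_pos_right _ (by omega))))
    calc 4 * L + g + 1 ≤ 2 * 2 ^ (g * (d + 8)) := by omega
      _ ≤ 2 ^ g * 2 ^ (g * (d + 8)) := by gcongr
      _ = 2 ^ w := by rw [hw]; ring
  have hnp : n + 1 ≤ p := by omega
  have hκp : 2 * (c + k) * n + 1 ≤ p := by
    rw [mul_assoc]
    omega
  have hnw : n + 1 ≤ 2 ^ w := hnp.trans hpw
  have hκw : 2 * (c + k) * n + 1 ≤ 2 ^ w := hκp.trans hpw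
  obtain ⟨e, he⟩ : ∃ e, e = w * (2 * (c + k)) + (w * (2 * (n * (2 * b))) +
      w * ((2 * (c + k)) ^ 2 + c * n) + w * (c * n)) + w +
      w * (2 * (3 * (n * (2 * b))) + c * n) := ⟨_, rfl⟩
  refine ⟨4 * L + g, e, ?_, ?_, ?_⟩
  · have h1 : g ≤ (n / k + 1) * g := Nat.le_mul_of_pos_left _ (Nat.succ_pos _)
    have h2 : L = (d + 3) * ((n / k + 1) * g) := by rw [hL]; ring
    have h3 : g ≤ (d + 3) * ((n / k + 1) * g) := h1.trans (Nat.le_mul_of_pos_left _ (by omega))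
    calc 4 * L + g ≤ 9 * L := by omega
      _ = _ := by rw [h2]; ring
  · have hb1 : 1 ≤ b' := by rw [hb']; exact Nat.mul_pos (by omega) hg1
    rw [he]
    refine (space_exponent_le hc hck hnLk hb1 hb).trans_eq ?_
    rw [hw, hb']
    ring
  · refine exists_steiner_algorithm (M := n ^ d) (ℓ := (d + 3) * g) (p := p) (b := b) hn hc hLpos
      (by positivity) hLk ?_ ?_ hn2 hnp ((Nat.le_succ _).trans hκp) ?_
    · calc 2 * n ^ d * n ^ 2 ≤ 2 ^ g * (2 ^ g) ^ d * (2 ^ g) ^ 2 := by gcongr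
        _ = _ := by ring
    · calc 2 * n ^ d * (n * (4 * L + 1)) * 4 ^ ((c + k) / L + 1)
          ≤ 2 ^ g * (2 ^ g) ^ d * (2 ^ g * 2 ^ (g * (d + 8))) * 4 ^ ((c + k) / L + 1) := by gcongr
        _ = 2 ^ b' * (2 ^ 2) ^ ((c + k) / L + 1) := by rw [hb']; ring
        _ = 2 ^ b := by rw [hb, ← pow_mul, ← pow_add]; congr 1; ring
    · have hgw : g ≤ w := by rw [hw]; exact Nat.le_mul_of_pos_left _ (by omega)
      rw [he]
      exact memory_size_le hnw hLw hκw hPw hpw hgw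

theorem mainTheorem12 :
    ∀ d : ℕ, ∃ (C : ℝ) (a : ℕ), ∀ n c k : ℕ, 1 ≤ c → c ≤ k → k ≤ n →
      ∃ p s : ℕ,
        (p : ℝ) ≤ C * ((n : ℝ) / (k : ℝ)) * Real.log ((n : ℝ) + 1) ^ a ∧
        (s : ℝ) ≤ C * ((c : ℝ) * (n : ℝ) + (k : ℝ) ^ 2) * Real.log ((n : ℝ) + 1) ^ a ∧
        ∃ A : StreamingAlgorithm (Finset (Fin n)) (EdgeUpdate (Fin n)) (PartialGraph (Fin n)) s,
          ∀ G : SimpleGraph (Fin n), G.Connected →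
          ∀ S : Finset (Fin n), S.card = c →
          ∀ σ : List (EdgeUpdate (Fin n)), IsTurnstileStream G σ →
            ENNReal.ofReal (1 - 1 / (n : ℝ) ^ d) ≤
              (A.run p S σ).toOuterMeasure {T | IsTwoApproxSteinerTree G S T} := by
  intro d
  -- `1800 = 200 * 9`, where 9 comes from `g ≤ 3 * log (n + 1)`, squared; this also dominates the
  -- constant `162 * (d + 3)` for the passes.
  refine ⟨1800 * ((d + 9) * (2 * d + 10)), 2, fun n c k hc hck hkn => ?_⟩
  have hn : 1 ≤ n := by omega
  have hgn : Nat.clog 2 (n + 1) ≤ n := Nat.clog_le_of_le_pow Nat.lt_two_pow_self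
  obtain ⟨p, s, hp, hs, A, hA⟩ := SteinerStream.exists_steiner_algorithm_of_clog (d := d) hc hck hkn
    (Nat.le_pow_clog (by norm_num) (n + 1)) hgn
  set g := Nat.clog 2 (n + 1) with hg
  have hn' : (1 : ℝ) ≤ n := by exact_mod_cast hn
  have hlog2 : Real.log 2 ≤ Real.log ((n : ℝ) + 1) :=
    Real.log_le_log (by norm_num) (by linarith)
  have hlog := Real.log_two_gt_d9
  have hg1 : 1 ≤ g := Nat.clog_pos (by norm_num) (by omega)
  have hgR : (1 : ℝ) ≤ g := by exact_mod_cast hg1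
  have hgx : (g : ℝ) ≤ 3 * Real.log ((n : ℝ) + 1) := by
    have h1 : 2 ^ (g - 1) < n + 1 := Nat.pow_pred_clog_lt_self (by norm_num) (by omega)
    have h2 : ((2 : ℝ) ^ (g - 1)) ≤ (n : ℝ) + 1 := by exact_mod_cast h1.le
    have h3 := Real.log_le_log (by positivity) h2
    rw [Real.log_pow, Nat.cast_sub hg1, Nat.cast_one] at h3
    nlinarith
  have hg2 : (g : ℝ) ^ 2 ≤ 9 * Real.log ((n : ℝ) + 1) ^ 2 := by nlinarith
  have hk : (0 : ℝ) < k := by exact_mod_cast (by omega : 0 < k)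
  refine ⟨p, s, ?_, ?_, A, ?_⟩
  · have h1 : ((n / k : ℕ) : ℝ) ≤ (n : ℝ) / k := Nat.cast_div_le
    have h2 : (1 : ℝ) ≤ (n : ℝ) / k := by
      rw [one_le_div hk]
      exact_mod_cast hkn
    have h3 : (p : ℝ) ≤ (9 * (d + 3)) * (((n / k : ℕ) + 1) * g) := by exact_mod_cast hp
    have hd : (0 : ℝ) ≤ d := Nat.cast_nonneg d
    calc (p : ℝ) ≤ (9 * (d + 3)) * (((n / k : ℕ) + 1) * g) := h3
      _ ≤ (9 * (d + 3)) * ((n / k + n / k) * (9 * Real.log ((n : ℝ) + 1) ^ 2)) := by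
          gcongr
          exact (by nlinarith : (g : ℝ) ≤ g ^ 2).trans hg2
      _ = (162 * (d + 3)) * ((n : ℝ) / k) * Real.log ((n : ℝ) + 1) ^ 2 := by ring
      _ ≤ _ := by
          gcongr
          · norm_num
          · nlinarith
  · have h3 : (s : ℝ) ≤ 200 * ((d + 9) * (2 * d + 10)) * ((c * n + k ^ 2) * g ^ 2) := by
      exact_mod_cast hs
    calc (s : ℝ) ≤ 200 * ((d + 9) * (2 * d + 10)) * ((c * n + k ^ 2) * g ^ 2) := h3
      _ ≤ 200 * ((d + 9) * (2 * d + 10)) *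
          ((c * n + k ^ 2) * (9 * Real.log ((n : ℝ) + 1) ^ 2)) := by gcongr
      _ = _ := by ring
  · simpa only [Nat.cast_pow] using hA
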